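/- Let $V(\mathbb Z)$ be a lattice (a free abelian group of finite rank), $V(\mathbb Q)=V(\mathbb Z)\otimes\mathbb Q$ and $V=V(\mathbb Q)\otimes\mathbb R$. A polyhedral cone (resp. rational polyhedral cone) is the set of all nonnegative real combinations of finitely many vectors (resp. of finitely many vectors in $V(\mathbb Q)$). Let $\Gamma$ be a group and $\rho\colon\Gamma\to \mathrm{GL}(V)$ a homomorphism such that the resulting action leaves invariant some lattice in $V(\mathbb Q)$ of full rank and a non-empty open convex cone $C\subset V$. Put $C_+=\mathrm{Conv}(\overline C\cap V(\mathbb Q))$, the convex hull of the rational points of $\overline C$. Let $W$ be the maximal real vector subspace of $V$ contained in $\overline C$ (it is $\Gamma$-invariant), and suppose that $W$ is defined over $\mathbb Q$, that is, $W$ is spanned over $\mathbb R$ by $W\cap V(\mathbb Q)$. Equip $V/W$ with the lattice that is the image of $V(\mathbb Z)$, let $\widetilde C$ be the image of $C$ in $V/W$, let $\widetilde C_+$ be the convex hull of the rational points of the closure of $\widetilde C$, and let $\widetilde\Gamma$ be the image of $\Gamma\to\mathrm{GL}(V/W)$. Suppose that $(\widetilde C_+,\widetilde\Gamma)$ is of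 polyhedral type, that is, there is a polyhedral cone $\widetilde Q\subset\widetilde C_+$ with $\widetilde\Gamma\cdot\widetilde Q\supset\widetilde C$. Then there is a rational polyhedral cone $\Pi\subset C_+$ such that $\Gamma\cdot\Pi=C_+$ and, for each $\gamma\in\Gamma$, either $\gamma\Pi\cap\mathrm{Int}(\Pi)=\emptyset$ or $\gamma\Pi=\Pi$, where $\mathrm{Int}$ denotes the relative interior. Moreover, $$\{\gamma\in\Gamma\mid\gamma\Pi=\Pi\}=\{\gamma\in\Gamma\mid\gamma\text{ acts trivially on }V/W\}.$$ -/

import Mathlib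

/-- The rational points `L ⊗ ℚ` of a vector space with lattice `L`: the vectors having a positive
integral multiple in `L`. -/
def ratPoints {E : Type*} [AddCommGroup E] (L : Submodule ℤ E) : Set E :=
  {v | ∃ n : ℕ, 0 < n ∧ n • v ∈ L}

/-- A polyhedral cone: the set of all nonnegative real combinations of finitely many vectors. -/
def IsPolyhedralCone {E : Type*} [AddCommGroup E] [Module ℝ E] (P : Set E) : Prop :=
  ∃ s : Finset E, P = (PointedCone.hull ℝ (s : Set E) : Set E)

/-- A rational polyhedral cone: the generators can be chosen to be rational. -/
def IsRationalPolyhedralCone {E : Type*} [AddCommGroup E] [Module ℝ E] (L : Submodule ℤ E)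
    (P : Set E) : Prop :=
  ∃ s : Finset E, (s : Set E) ⊆ ratPoints L ∧ P = (PointedCone.hull ℝ (s : Set E) : Set E)

/-- `C₊`: the convex hull of the rational points of the closure of `C`. -/
def conePlus {E : Type*} [AddCommGroup E] [Module ℝ E] [TopologicalSpace E] (L : Submodule ℤ E)
    (C : Set E) : Set E :=
  convexHull ℝ (closure C ∩ ratPoints L)

/-- `(C₊, Γ)` is of polyhedral type, where `Γ` acts through `ρ`. -/
def IsPolyhedralType {E : Type*} [AddCommGroup E] [Module ℝ E] [TopologicalSpace E]
    (L : Submodule ℤ E) (C : Set E) {Γ : Type*} [Group Γ] (ρ : Γ →* (E ≃ₗ[ℝ] E)) : Prop :=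
  ∃ P : Set E, IsPolyhedralCone P ∧ P ⊆ conePlus L C ∧ C ⊆ ⋃ γ : Γ, ρ γ '' P

/-- `W` is the maximal vector space contained in the closure of `C`. -/
def IsMaximalSubspace {E : Type*} [AddCommGroup E] [Module ℝ E] [TopologicalSpace E]
    (C : Set E) (W : Submodule ℝ E) : Prop :=
  IsGreatest {U : Submodule ℝ E | (U : Set E) ⊆ closure C} W

/-- A real subspace `W` is defined over `ℚ` if it is spanned by its rational points. -/
def IsDefinedOverRat {E : Type*} [AddCommGroup E] [Module ℝ E] (L : Submodule ℤ E)
    (W : Submodule ℝ E) : Prop :=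
  Submodule.span ℝ ((W : Set E) ∩ ratPoints L) = W

/-- The lattice of `E ⧸ W` induced by `L`: the image of `L`. -/
def quotientLattice {E : Type*} [AddCommGroup E] [Module ℝ E] (L : Submodule ℤ E)
    (W : Submodule ℝ E) : Submodule ℤ (E ⧸ W) :=
  L.map (W.mkQ.restrictScalars ℤ)

/-- The maximal vector space in the closure of an invariant set is invariant. -/
theorem IsMaximalSubspace.map_eq {E : Type*} [NormedAddCommGroup E] [NormedSpace ℝ E]
    [FiniteDimensional ℝ E] {Γ : Type*} [Group Γ] {ρ : Γ →* (E ≃ₗ[ℝ] E)} {C : Set E}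
    {W : Submodule ℝ E} (hW : IsMaximalSubspace C W) (hC : ∀ γ, ρ γ '' C = C) (γ : Γ) :
    W.map (ρ γ : E →ₗ[ℝ] E) = W := by
  have key : ∀ γ, W.map (ρ γ : E →ₗ[ℝ] E) ≤ W := by
    intro γ
    apply hW.2
    rintro _ ⟨x, hx, rfl⟩
    have h := image_closure_subset_closure_image
      (LinearMap.continuous_of_finiteDimensional (ρ γ : E →ₗ[ℝ] E)) (s := C)
      ⟨x, hW.1 hx, rfl⟩
    have h2 : (ρ γ : E →ₗ[ℝ] E) '' C = C := hC γ
    rwa [h2] at h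
  refine le_antisymm (key γ) fun x hx => ?_
  refine ⟨ρ γ⁻¹ x, key γ⁻¹ ⟨x, hx, rfl⟩, ?_⟩
  change (ρ γ * ρ γ⁻¹) x = x
  rw [← map_mul]
  simp

/-- The action on `E ⧸ W` induced by an action on `E` which leaves `W` invariant. -/
def quotientAction {E : Type*} [AddCommGroup E] [Module ℝ E] {Γ : Type*} [Group Γ]
    (ρ : Γ →* (E ≃ₗ[ℝ] E)) (W : Submodule ℝ E)
    (h : ∀ γ, W.map (ρ γ : E →ₗ[ℝ] E) = W) : Γ →* ((E ⧸ W) ≃ₗ[ℝ] (E ⧸ W)) where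
  toFun γ := Submodule.Quotient.equiv W W (ρ γ) (h γ)
  map_one' := by
    ext x
    induction x using Submodule.Quotient.induction_on
    simp
  map_mul' a b := by
    ext x
    induction x using Submodule.Quotient.induction_on
    simp

/-! The cone Π is a Dirichlet domain. Take a linear functional ξ, integral on the invariant lattice
L and nonnegative on the closure of C, and let D be the set of points of C₊ at which ξ is minimal on
the Γ-orbit. C₊ is the cone generated by the set A of points of L in the closure of C, and ξ has
values in ℕ on A. On a cone generated by finitely many points of A, Dickson's lemma leaves finitely
many candidates for the minimum of the ξ ∘ γ. Hence every orbit in C₊ attains its minimum, and the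
translates of D cover all of C₊, not only C.

By `exists_integral_functional`, ξ can be chosen so that its stabilizer acts trivially on V/W. If γD
meets the interior of D, then ξ ∘ γ = ξ, so γ is trivial modulo W. Such a γ preserves D, because ξ
vanishes on W and W ⊆ D.

For `exists_finset_hull_eq_dirichletCone`, the polyhedral type hypothesis is lifted to a cone
generated by a finite subset of A, containing W, whose translates cover C. Finitely many f ∈ Γ
suffice to minimize ξ on it, which cuts it into finitely many rational cones; moving each by its f
lands in D. A generic interior point of D agrees with a point of such a piece up to an element
stabilizing ξ, that is, up to W. Since D has interior points (Baire) and finitely generated cones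
are closed, the pieces generate D. -/

open PointedCone

/-! ### Finitely generated cones and half spaces -/

theorem nonneg_of_mem_hull {E : Type*} [AddCommGroup E] [Module ℝ E] {s : Set E}
    {φ : E →ₗ[ℝ] ℝ} (h : ∀ x ∈ s, 0 ≤ φ x) {x : E} (hx : x ∈ hull ℝ s) : 0 ≤ φ x := by
  induction hx using Submodule.span_induction with
  | mem x hx => exact h x hx
  | zero => simp
  | add x y _ _ hx hy => rw [map_add]; exact add_nonneg hx hy
  | smul c x _ hx =>
    rw [← Nonneg.coe_smul, map_smul]
    exact mul_nonneg c.2 hx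

/-- The double description step: a generating set of the intersection of the cone generated by
`s` with a half space. -/
theorem mem_hull_inter_halfspace {E : Type*} [AddCommGroup E] [Module ℝ E] {s t : Set E}
    {φ : E →ₗ[ℝ] ℝ} (h₁ : ∀ a ∈ s, 0 ≤ φ a → a ∈ t)
    (h₂ : ∀ a ∈ s, 0 ≤ φ a → ∀ b ∈ s, φ b < 0 → φ a • b - φ b • a ∈ t)
    {x : E} (hx : x ∈ hull ℝ s) (hφx : 0 ≤ φ x) : x ∈ hull ℝ t := by
  have hs : s = {a ∈ s | 0 ≤ φ a} ∪ {a ∈ s | φ a < 0} := by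
    ext a
    simp only [Set.mem_union, Set.mem_ofPred_eq, ← and_or_left, le_or_gt, and_true]
  rw [hs, hull, Submodule.span_union] at hx
  obtain ⟨u, hu, v, hv, rfl⟩ := Submodule.mem_sup.1 hx
  have hu0 : 0 ≤ φ u := nonneg_of_mem_hull (fun a ha => ha.2) hu
  have hut : u ∈ hull ℝ t := Submodule.span_mono (fun a ha => h₁ a ha.1 ha.2) hu
  have hv0 : φ v < 0 ∨ v = 0 := by
    clear hx hφx
    induction hv using Submodule.span_induction with
    | mem a ha => exact Or.inl ha.2
    | zero => exact Or.inr rfl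
    | add a b _ _ ha hb =>
      rcases ha with ha | rfl
      · left
        rcases hb with hb | rfl
        · rw [map_add]; linarith
        · simpa using ha
      · simpa using hb
    | smul c a _ ha =>
      rcases ha with ha | rfl
      · rcases eq_or_lt_of_le c.2 with hc | hc
        · right
          rw [← Nonneg.coe_smul, ← hc, zero_smul]
        · left
          rw [← Nonneg.coe_smul, map_smul]
          exact mul_neg_of_pos_of_neg hc ha
      · simp
  -- The expression is bilinear in (u, v), so it suffices to check generators.
  have key : φ u • v - φ v • u ∈ hull ℝ t := by
    clear hx hφx hv0 hu0 hut
    induction hu using Submodule.span_induction with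
    | mem a ha =>
      induction hv using Submodule.span_induction with
      | mem b hb => exact subset_hull (h₂ a ha.1 ha.2 b hb.1 hb.2)
      | zero => simp
      | add b c _ _ hb hc =>
        convert! add_mem hb hc using 1
        rw [map_add]; module
      | smul c b _ hb =>
        convert! smul_mem _ c.2 hb using 1
        rw [← Nonneg.coe_smul, map_smul]
        module
    | zero => simp
    | add b c _ _ hb hc =>
      convert! add_mem hb hc using 1
      rw [map_add]; module
    | smul c b _ hb =>
      convert! smul_mem _ c.2 hb using 1
      rw [← Nonneg.coe_smul, map_smul]
      module
  rcases hv0 with hv0 | rfl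
  · rw [map_add] at hφx
    have hpos : 0 < φ u := by linarith
    -- φ u • (u + v) = φ (u + v) • u + (φ u • v - φ v • u), with both summands in the cone.
    rw [← smul_mem_iff _ hpos]
    convert! add_mem (smul_mem _ hφx hut) key using 1
    module
  · simpa using hut

/-- Integrality of φ on L makes the new generators φ a • b - φ b • a integral combinations of
lattice points; this is what keeps the Dirichlet cone rational. -/
theorem exists_finset_hull_inter_halfspace {E : Type*} [AddCommGroup E] [Module ℝ E]
    {L : Submodule ℤ E} {φ : E →ₗ[ℝ] ℝ} (hφ : ∀ x ∈ L, ∃ k : ℤ, φ x = k) {s : Finset E}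
    (hs : (s : Set E) ⊆ L) :
    ∃ t : Finset E, (t : Set E) ⊆ L ∧ ∀ x, x ∈ hull ℝ (t : Set E) ↔
      x ∈ hull ℝ (s : Set E) ∧ 0 ≤ φ x := by
  classical
  let t : Finset E := {a ∈ s | 0 ≤ φ a} ∪
    Finset.image₂ (fun a b => φ a • b - φ b • a) {a ∈ s | 0 ≤ φ a} {a ∈ s | φ a < 0}
  have ht : ∀ x ∈ t, x ∈ L ∧ x ∈ hull ℝ (s : Set E) ∧ 0 ≤ φ x := by
    intro x hx
    rcases Finset.mem_union.1 hx with hx | hx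
    · rw [Finset.mem_filter] at hx
      exact ⟨hs hx.1, subset_hull hx.1, hx.2⟩
    · obtain ⟨a, ha, b, hb, rfl⟩ := Finset.mem_image₂.1 hx
      rw [Finset.mem_filter] at ha hb
      refine ⟨?_, ?_, ?_⟩
      · obtain ⟨k, hk⟩ := hφ a (hs ha.1)
        obtain ⟨l, hl⟩ := hφ b (hs hb.1)
        rw [hk, hl, Int.cast_smul_eq_zsmul, Int.cast_smul_eq_zsmul]
        exact sub_mem (L.smul_mem _ (hs hb.1)) (L.smul_mem _ (hs ha.1))
      · rw [sub_eq_add_neg, ← neg_smul]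
        exact add_mem (smul_mem _ ha.2 (subset_hull hb.1))
          (smul_mem _ (neg_nonneg.2 hb.2.le) (subset_hull ha.1))
      · simp [mul_comm]
  refine ⟨t, fun x hx => (ht x hx).1, fun x => ⟨fun hx => ⟨?_, ?_⟩, fun hx => ?_⟩⟩
  · exact Submodule.span_le.2 (fun y hy => (ht y hy).2.1) hx
  · exact nonneg_of_mem_hull (fun y hy => (ht y hy).2.2) hx
  · refine mem_hull_inter_halfspace (φ := φ) (fun a ha h => ?_) (fun a ha h b hb h' => ?_) hx.1 hx.2
    · exact Finset.mem_union_left _ (Finset.mem_filter.2 ⟨ha, h⟩)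
    · exact Finset.mem_union_right _ (Finset.mem_image₂_of_mem (Finset.mem_filter.2 ⟨ha, h⟩)
        (Finset.mem_filter.2 ⟨hb, h'⟩))

theorem exists_finset_hull_inter_halfspaces {E : Type*} [AddCommGroup E] [Module ℝ E]
    {L : Submodule ℤ E} {ι : Type*} (F : Finset ι) {φ : ι → E →ₗ[ℝ] ℝ}
    (hφ : ∀ i, ∀ x ∈ L, ∃ k : ℤ, φ i x = k) {s : Finset E} (hs : (s : Set E) ⊆ L) :
    ∃ t : Finset E, (t : Set E) ⊆ L ∧ ∀ x, x ∈ hull ℝ (t : Set E) ↔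
      x ∈ hull ℝ (s : Set E) ∧ ∀ i ∈ F, 0 ≤ φ i x := by
  classical
  induction F using Finset.induction_on with
  | empty => exact ⟨s, hs, by simp⟩
  | insert i F _ ih =>
    obtain ⟨t, htL, ht⟩ := ih
    obtain ⟨t', htL', ht'⟩ := exists_finset_hull_inter_halfspace (hφ i) htL
    refine ⟨t', htL', fun x => ?_⟩
    rw [ht', ht, Finset.forall_mem_insert]
    tauto

/-- One step of Fourier–Motzkin elimination. -/
theorem exists_finset_forall_nonneg_sub_smul {E : Type*} [AddCommGroup E] [Module ℝ E]
    (T : Finset (E →ₗ[ℝ] ℝ)) (v : E) :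
    ∃ T' : Finset (E →ₗ[ℝ] ℝ), ∀ x, (∀ a ∈ T', 0 ≤ a x) ↔
      ∃ t : ℝ, 0 ≤ t ∧ ∀ a ∈ T, 0 ≤ a (x - t • v) := by
  classical
  refine ⟨{a ∈ T | 0 ≤ a v} ∪
    Finset.image₂ (fun a b => a v • b - b v • a) {a ∈ T | 0 ≤ a v} {a ∈ T | a v < 0},
    fun x => ⟨fun h => ?_, ?_⟩⟩
  · have h₁ : ∀ a ∈ T, 0 ≤ a v → 0 ≤ a x := fun a ha hav =>
      h a (Finset.mem_union_left _ (Finset.mem_filter.2 ⟨ha, hav⟩))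
    have h₂ : ∀ a ∈ T, 0 ≤ a v → ∀ b ∈ T, b v < 0 → 0 ≤ a v * b x - b v * a x :=
      fun a ha hav b hb hbv => by
        simpa using h _ (Finset.mem_union_right _ (Finset.mem_image₂_of_mem
          (Finset.mem_filter.2 ⟨ha, hav⟩) (Finset.mem_filter.2 ⟨hb, hbv⟩)))
    -- Functionals negative on v bound t from below, those positive on v bound it from above. The
    -- largest lower bound works; the element 0 encodes t ≥ 0.
    let U : Finset ℝ := insert 0 (Finset.image (fun b => b x / b v) {a ∈ T | a v < 0})
    have hU : U.Nonempty := Finset.insert_nonempty _ _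
    refine ⟨U.max' hU, U.le_max' _ (Finset.mem_insert_self _ _), fun a ha => ?_⟩
    rw [map_sub, map_smul, smul_eq_mul]
    rcases lt_or_ge (a v) 0 with hav | hav
    · have : a x / a v ≤ U.max' hU := U.le_max' _ (Finset.mem_insert_of_mem
        (Finset.mem_image_of_mem _ (Finset.mem_filter.2 ⟨ha, hav⟩)))
      rw [div_le_iff_of_neg hav] at this
      linarith
    · rcases Finset.mem_insert.1 (U.max'_mem hU) with h0 | h0
      · rw [h0]; simpa using h₁ a ha hav
      · obtain ⟨b, hb, hb'⟩ := Finset.mem_image.1 h0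
        rw [Finset.mem_filter] at hb
        rw [← hb', sub_nonneg, div_mul_eq_mul_div, div_le_iff_of_neg hb.2]
        have := h₂ a ha hav b hb.1 hb.2
        linarith
  · rintro ⟨t, ht, h⟩ a ha
    have h' : ∀ a ∈ T, t * a v ≤ a x := fun a ha => by simpa using h a ha
    rcases Finset.mem_union.1 ha with ha | ha
    · rw [Finset.mem_filter] at ha
      exact (mul_nonneg ht ha.2).trans (h' a ha.1)
    · obtain ⟨c, hc, b, hb, rfl⟩ := Finset.mem_image₂.1 ha
      rw [Finset.mem_filter] at hc hb
      have h₁ := mul_le_mul_of_nonneg_left (h' b hb.1) hc.2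
      have h₂ := mul_le_mul_of_nonpos_left (h' c hc.1) hb.2.le
      simp only [LinearMap.sub_apply, LinearMap.smul_apply, smul_eq_mul]
      linarith

theorem mem_hull_insert_iff {E : Type*} [AddCommGroup E] [Module ℝ E] {s : Set E} {v x : E} :
    x ∈ hull ℝ (insert v s) ↔ ∃ t : ℝ, 0 ≤ t ∧ x - t • v ∈ hull ℝ s := by
  rw [hull, Submodule.mem_span_insert]
  constructor
  · rintro ⟨a, z, hz, rfl⟩
    exact ⟨a, a.2, by simpa [← Nonneg.coe_smul] using hz⟩
  · rintro ⟨t, ht, h⟩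
    exact ⟨⟨t, ht⟩, _, h, by simp [← Nonneg.coe_smul]⟩

/-- A finitely generated cone is a finite intersection of half spaces. -/
theorem exists_finset_mem_hull_iff {E : Type*} [AddCommGroup E] [Module ℝ E]
    [FiniteDimensional ℝ E] (s : Finset E) :
    ∃ T : Finset (E →ₗ[ℝ] ℝ), ∀ x, x ∈ hull ℝ (s : Set E) ↔ ∀ a ∈ T, 0 ≤ a x := by
  classical
  induction s using Finset.induction_on with
  | empty =>
    let b := Module.finBasis ℝ E
    refine ⟨Finset.univ.image b.coord ∪ Finset.univ.image (fun i => -b.coord i), fun x => ?_⟩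
    simp only [Finset.coe_empty, hull, Submodule.span_empty, Submodule.mem_bot]
    constructor
    · rintro rfl
      simp
    · intro h
      refine b.ext_elem fun i => ?_
      have h₁ := h (b.coord i) (by simp)
      have h₂ := h (-b.coord i) (by simp)
      simp only [LinearMap.neg_apply, Module.Basis.coord_apply] at h₁ h₂
      rw [map_zero, Finsupp.zero_apply]
      linarith
  | insert v s _ ih =>
    obtain ⟨T, hT⟩ := ih
    obtain ⟨T', hT'⟩ := exists_finset_forall_nonneg_sub_smul T v
    refine ⟨T', fun x => ?_⟩
    rw [Finset.coe_insert, mem_hull_insert_iff, hT']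
    simp only [hT]

theorem isClosed_hull_finset {E : Type*} [NormedAddCommGroup E] [NormedSpace ℝ E]
    [FiniteDimensional ℝ E] (s : Finset E) : IsClosed (hull ℝ (s : Set E) : Set E) := by
  obtain ⟨T, hT⟩ := exists_finset_mem_hull_iff s
  have : (hull ℝ (s : Set E) : Set E) = ⋂ a ∈ T, {x | 0 ≤ a x} := by
    ext x
    simp [hT]
  rw [this]
  exact isClosed_biInter fun a _ =>
    isClosed_le continuous_const a.continuous_of_finiteDimensional

/-! ### Dickson's lemma and linear functionals -/

/-- Dickson's lemma, for families of functions. -/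
theorem exists_finset_forall_exists_le_of_nat {ι Γ : Type*} [Nonempty Γ] (s : Finset ι)
    (a : Γ → ι → ℕ) :
    ∃ F : Finset Γ, ∀ γ, ∃ f ∈ F, ∀ x ∈ s, a f x ≤ a γ x := by
  classical
  let g : Γ → s → ℕ := fun γ x => a γ x
  have hfin : {m | Minimal (· ∈ Set.range g) m}.Finite :=
    WellQuasiOrderedLE.finite_of_isAntichain (setOfPred_minimal_antichain _)
  have hpre : ∀ m ∈ {m | Minimal (· ∈ Set.range g) m}, ∃ γ, g γ = m := fun m hm => hm.1
  choose! p hp using hpre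
  refine ⟨hfin.toFinset.image p, fun γ => ?_⟩
  obtain ⟨m, hm, hmin⟩ := exists_minimal_le_of_wellFoundedLT (· ∈ Set.range g) (g γ) ⟨γ, rfl⟩
  refine ⟨p m, Finset.mem_image_of_mem _ (hfin.mem_toFinset.2 hmin), fun x hx => ?_⟩
  have := hm ⟨x, hx⟩
  rw [← hp m hmin] at this
  exact this

/-- An integral functional is determined by its integer values on a finite basis taken from L. Γ
need not be countable, but the orbit of ξ therefore is, which permits Baire arguments. -/
theorem countable_integral_functionals {V : Type*} [AddCommGroup V] [Module ℝ V]
    [FiniteDimensional ℝ V] {L : Set V} (hL : Submodule.span ℝ L = ⊤) :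
    {φ : V →ₗ[ℝ] ℝ | ∀ x ∈ L, ∃ k : ℤ, φ x = k}.Countable := by
  let b := Module.Basis.ofSpan hL.ge
  have hb : ∀ i, b i ∈ L := fun i => Module.Basis.ofSpan_subset hL.ge ⟨i, rfl⟩
  have := Module.Finite.finite_basis b
  choose! k hk using fun (φ : V →ₗ[ℝ] ℝ) (h : ∀ x ∈ L, ∃ k : ℤ, φ x = k) => h
  refine Set.MapsTo.countable_of_injOn (t := Set.univ) (f := fun φ i => k φ (b i))
    (fun _ _ => Set.mem_univ _) (fun φ hφ ψ hψ h => b.ext fun i => ?_) Set.countable_univ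
  rw [hk φ hφ _ (hb i), hk ψ hψ _ (hb i)]
  exact_mod_cast congrFun h i

theorem isOpen_ne_zero_functional {V : Type*} [NormedAddCommGroup V] [NormedSpace ℝ V]
    [FiniteDimensional ℝ V] (φ : V →ₗ[ℝ] ℝ) : IsOpen {x | φ x ≠ 0} :=
  isOpen_ne_fun φ.continuous_of_finiteDimensional continuous_const

theorem dense_ne_zero_functional {V : Type*} [NormedAddCommGroup V] [NormedSpace ℝ V]
    {φ : V →ₗ[ℝ] ℝ} (hφ : φ ≠ 0) : Dense {x | φ x ≠ 0} := by
  have h : interior (LinearMap.ker φ : Set V) = ∅ := by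
    by_contra h
    have := Submodule.eq_top_of_nonempty_interior' _ (Set.nonempty_iff_ne_empty.2 h)
    exact hφ (LinearMap.ker_eq_top.1 this)
  exact interior_eq_empty_iff_dense_compl.1 h

/-- Moving from y a little in the directions v and -v stays in s, so φ v has both signs. -/
theorem eq_zero_of_nonneg_of_mem_interior {V : Type*} [NormedAddCommGroup V] [NormedSpace ℝ V]
    {φ : V →ₗ[ℝ] ℝ} {s : Set V} (h : ∀ x ∈ s, 0 ≤ φ x) {y : V} (hy : y ∈ interior s)
    (hφy : φ y = 0) : φ = 0 := by
  ext v
  have hc : Continuous fun t : ℝ => y + t • v := by fun_prop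
  have h0 : ∀ᶠ t : ℝ in nhds 0, y + t • v ∈ interior s :=
    hc.continuousAt.eventually_mem (by simpa using isOpen_interior.mem_nhds hy)
  obtain ⟨ε, hε, H⟩ := Metric.eventually_nhds_iff.1 h0
  have h₁ := h _ (interior_subset (H (y := ε / 2)
    (by rw [Real.dist_eq, sub_zero, abs_of_pos (half_pos hε)]; linarith)))
  have h₂ := h _ (interior_subset (H (y := -(ε / 2))
    (by rw [Real.dist_eq, sub_zero, abs_neg, abs_of_pos (half_pos hε)]; linarith)))
  simp only [map_add, map_smul, hφy, smul_eq_mul] at h₁ h₂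
  rw [LinearMap.zero_apply]
  nlinarith

theorem intrinsicInterior_subset_interior {V : Type*} [NormedAddCommGroup V] [NormedSpace ℝ V]
    {s : Set V} (hs : (interior s).Nonempty) : intrinsicInterior ℝ s ⊆ interior s := by
  have htop : affineSpan ℝ s = ⊤ := by
    refine top_le_iff.1 ((isOpen_interior.affineSpan_eq_top hs).ge.trans ?_)
    exact affineSpan_mono ℝ interior_subset
  rintro _ ⟨x, hx, rfl⟩
  have ho : IsOpenMap (Subtype.val : affineSpan ℝ s → V) :=
    IsOpen.isOpenMap_subtype_val (by
      rw [htop, AffineSubspace.top_coe]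
      exact isOpen_univ)
  exact interior_maximal (Set.image_subset_iff.2 interior_subset) (ho _ isOpen_interior)
    ⟨x, hx, rfl⟩

/-! ### The Dirichlet domain of a functional -/

section Dirichlet

variable {V : Type*} [NormedAddCommGroup V] [NormedSpace ℝ V] {Γ : Type*} [Group Γ]

/-- The points of the cone `K` at which `ξ` is minimal on the orbit under `Γ`. -/
def dirichletCone (ρ : Γ →* (V ≃ₗ[ℝ] V)) (ξ : V →ₗ[ℝ] ℝ) (K : PointedCone ℝ V) :
    PointedCone ℝ V where
  carrier := {y | y ∈ K ∧ ∀ γ, ξ y ≤ ξ (ρ γ y)}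
  zero_mem' := ⟨K.zero_mem, by simp⟩
  add_mem' {x y} hx hy := ⟨K.add_mem hx.1 hy.1, fun γ => by
    simpa using add_le_add (hx.2 γ) (hy.2 γ)⟩
  smul_mem' c x hx := ⟨K.smul_mem c.2 hx.1, fun γ => by
    simp only [← Nonneg.coe_smul, map_smul, smul_eq_mul]
    exact mul_le_mul_of_nonneg_left (hx.2 γ) c.2⟩

theorem apply_mul_apply (ρ : Γ →* (V ≃ₗ[ℝ] V)) (a b : Γ) (x : V) : ρ (a * b) x = ρ a (ρ b x) := by
  rw [map_mul]; rfl

theorem apply_inv_apply (ρ : Γ →* (V ≃ₗ[ℝ] V)) (a : Γ) (x : V) : ρ a⁻¹ (ρ a x) = x := by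
  rw [← apply_mul_apply, inv_mul_cancel, map_one]; rfl

theorem apply_apply_inv (ρ : Γ →* (V ≃ₗ[ℝ] V)) (a : Γ) (x : V) : ρ a (ρ a⁻¹ x) = x := by
  rw [← apply_mul_apply, mul_inv_cancel, map_one]; rfl

theorem apply_mem_hull {ρ : Γ →* (V ≃ₗ[ℝ] V)} {A : Set V} (hA : ∀ γ, ∀ x ∈ A, ρ γ x ∈ A) (γ : Γ)
    {x : V} (hx : x ∈ hull ℝ A) : ρ γ x ∈ hull ℝ A := by
  induction hx using Submodule.span_induction with
  | mem x hx => exact subset_hull (hA γ x hx)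
  | zero => simp
  | add x y _ _ hx hy => rw [map_add]; exact add_mem hx hy
  | smul c x _ hx =>
    rw [← Nonneg.coe_smul, map_smul]
    exact smul_mem _ c.2 hx

/-- On a cone generated by finitely many lattice points, `ξ ∘ γ` is bounded below by one of
finitely many of these functionals. -/
theorem exists_finset_forall_exists_le {ρ : Γ →* (V ≃ₗ[ℝ] V)} {ξ : V →ₗ[ℝ] ℝ} {s : Finset V}
    (h : ∀ γ, ∀ x ∈ s, ∃ k : ℕ, ξ (ρ γ x) = k) :
    ∃ F : Finset Γ, ∀ γ, ∃ f ∈ F, ∀ x ∈ hull ℝ (s : Set V), ξ (ρ f x) ≤ ξ (ρ γ x) := by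
  choose! k hk using h
  obtain ⟨F, hF⟩ := exists_finset_forall_exists_le_of_nat s k
  refine ⟨F, fun γ => ?_⟩
  obtain ⟨f, hf, h⟩ := hF γ
  refine ⟨f, hf, fun x hx => ?_⟩
  have := nonneg_of_mem_hull (φ := ξ ∘ₗ (ρ γ : V →ₗ[ℝ] V) - ξ ∘ₗ (ρ f : V →ₗ[ℝ] V))
    (fun y hy => ?_) hx
  · simpa using this
  · simpa [hk γ y hy, hk f y hy] using h y hy

/-- Each point lies in the cone over finitely many elements of A, and there only finitely many
functionals ξ ∘ γ compete for the minimum. No fundamental domain is needed. -/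
theorem exists_apply_mem_dirichletCone {ρ : Γ →* (V ≃ₗ[ℝ] V)} {ξ : V →ₗ[ℝ] ℝ} {A : Set V}
    (hA : ∀ γ, ∀ x ∈ A, ρ γ x ∈ A) (hξ : ∀ x ∈ A, ∃ k : ℕ, ξ x = k) {x : V}
    (hx : x ∈ hull ℝ A) : ∃ γ, ρ γ x ∈ dirichletCone ρ ξ (hull ℝ A) := by
  obtain ⟨s, hsA, hxs⟩ := Submodule.mem_span_finite_of_mem_span hx
  obtain ⟨F, hF⟩ := exists_finset_forall_exists_le (ρ := ρ) (ξ := ξ) (s := s)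
    fun γ y hy => hξ _ (hA γ y (hsA hy))
  have hne : F.Nonempty := let ⟨f, hf, _⟩ := hF 1; ⟨f, hf⟩
  obtain ⟨g, hg, hmin⟩ := F.exists_min_image (fun f => ξ (ρ f x)) hne
  refine ⟨g, apply_mem_hull hA g hx, fun γ => ?_⟩
  obtain ⟨f, hf, h⟩ := hF (γ * g)
  rw [← apply_mul_apply]
  exact (hmin f hf).trans (h x hxs)

theorem iUnion_image_dirichletCone {ρ : Γ →* (V ≃ₗ[ℝ] V)} {ξ : V →ₗ[ℝ] ℝ} {A : Set V}
    (hA : ∀ γ, ∀ x ∈ A, ρ γ x ∈ A) (hξ : ∀ x ∈ A, ∃ k : ℕ, ξ x = k) :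
    ⋃ γ, ρ γ '' (dirichletCone ρ ξ (hull ℝ A) : Set V) = hull ℝ A := by
  ext x
  simp only [Set.mem_iUnion, Set.mem_image]
  constructor
  · rintro ⟨γ, y, hy, rfl⟩
    exact apply_mem_hull hA γ hy.1
  · intro hx
    obtain ⟨γ, h⟩ := exists_apply_mem_dirichletCone hA hξ hx
    exact ⟨γ⁻¹, _, h, apply_inv_apply ρ γ x⟩

/-- At y both ξ and ξ ∘ γ⁻¹ attain the minimum over the orbit. Their difference ξ ∘ γ⁻¹ - ξ is
nonnegative on D and vanishes at an interior point of D, hence is zero. -/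
theorem functional_invariant_of_mem_interior {ρ : Γ →* (V ≃ₗ[ℝ] V)} {ξ : V →ₗ[ℝ] ℝ}
    {K : PointedCone ℝ V} {γ : Γ} {y : V} (hy : y ∈ ρ γ '' (dirichletCone ρ ξ K : Set V))
    (hy' : y ∈ interior (dirichletCone ρ ξ K : Set V)) (x : V) : ξ (ρ γ x) = ξ x := by
  have h0 : ξ ∘ₗ (ρ γ⁻¹ : V →ₗ[ℝ] V) - ξ = 0 := by
    refine eq_zero_of_nonneg_of_mem_interior (fun z hz => ?_) hy' ?_
    · simpa using hz.2 γ⁻¹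
    · obtain ⟨z, hz, rfl⟩ := hy
      have h₁ := hz.2 γ
      have h₂ := (interior_subset hy').2 γ⁻¹
      rw [apply_inv_apply] at h₂
      simp only [LinearMap.sub_apply, LinearMap.comp_apply, LinearEquiv.coe_coe, apply_inv_apply]
      linarith
  have := LinearMap.congr_fun h0 (ρ γ x)
  simp only [LinearMap.sub_apply, LinearMap.comp_apply, LinearEquiv.coe_coe, apply_inv_apply,
    LinearMap.zero_apply] at this
  linarith

end Dirichlet

/-! ### Finite generation of the Dirichlet cone -/

section Polyhedral

variable {V : Type*} [NormedAddCommGroup V] [NormedSpace ℝ V] [FiniteDimensional ℝ V]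
  {Γ : Type*} [Group Γ]

theorem countable_orbit_functional {ρ : Γ →* (V ≃ₗ[ℝ] V)} {ξ : V →ₗ[ℝ] ℝ} {L : Submodule ℤ V}
    (hL : Submodule.span ℝ (L : Set V) = ⊤) (hρL : ∀ γ, ∀ x ∈ L, ρ γ x ∈ L)
    (hξL : ∀ x ∈ L, ∃ k : ℤ, ξ x = k) :
    (Set.range fun γ => ξ ∘ₗ (ρ γ : V →ₗ[ℝ] V)).Countable := by
  refine (countable_integral_functionals hL).mono ?_
  rintro _ ⟨γ, rfl⟩ x hx
  exact hξL _ (hρL γ x hx)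

/-- Baire category: C is covered by the closed sets on which one given functional of the countable
orbit of ξ is minimal, so one of them has interior inside C, and the corresponding γ moves it into
the Dirichlet cone. -/
theorem nonempty_interior_dirichletCone {ρ : Γ →* (V ≃ₗ[ℝ] V)} {ξ : V →ₗ[ℝ] ℝ}
    {L : Submodule ℤ V} (hL : Submodule.span ℝ (L : Set V) = ⊤)
    (hρL : ∀ γ, ∀ x ∈ L, ρ γ x ∈ L) (hξL : ∀ x ∈ L, ∃ k : ℤ, ξ x = k)
    {A : Set V} (hA : ∀ γ, ∀ x ∈ A, ρ γ x ∈ A) (hξA : ∀ x ∈ A, ∃ k : ℕ, ξ x = k)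
    {C : Set V} (hC : IsOpen C) (hCne : C.Nonempty) (hCA : C ⊆ hull ℝ A) :
    (interior (dirichletCone ρ ξ (hull ℝ A) : Set V)).Nonempty := by
  let T := Set.range fun γ => ξ ∘ₗ (ρ γ : V →ₗ[ℝ] V)
  have : Countable T := (countable_orbit_functional hL hρL hξL).to_subtype
  -- The index `none` carries the complement of C, so that the closed sets cover the whole space.
  let f : Option T → Set V := fun o => o.elim Cᶜ fun φ => {y | ∀ γ, φ.1 y ≤ ξ (ρ γ y)}
  have hf : ∀ o, IsClosed (f o) := by
    rintro (_ | φ)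
    · exact hC.isClosed_compl
    · have : f (some φ) = ⋂ γ, {y | φ.1 y ≤ ξ (ρ γ y)} := by ext; simp [f]
      rw [this]
      exact isClosed_iInter fun γ => isClosed_le φ.1.continuous_of_finiteDimensional
        (ξ ∘ₗ (ρ γ : V →ₗ[ℝ] V)).continuous_of_finiteDimensional
  have hcover : ⋃ o, f o = Set.univ := by
    refine Set.eq_univ_of_forall fun y => ?_
    by_cases hy : y ∈ C
    · obtain ⟨γ, hγ⟩ := exists_apply_mem_dirichletCone hA hξA (hCA hy)
      refine Set.mem_iUnion.2 ⟨some ⟨_, γ, rfl⟩, fun γ' => ?_⟩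
      have := hγ.2 (γ' * γ⁻¹)
      rwa [apply_mul_apply, apply_inv_apply] at this
    · exact Set.mem_iUnion.2 ⟨none, hy⟩
  obtain ⟨z, hzC, hz⟩ := (dense_iUnion_interior_of_closed hf hcover).inter_open_nonempty C hC hCne
  obtain ⟨_ | ⟨_, γ, rfl⟩, ho⟩ := Set.mem_iUnion.1 hz
  · exact absurd hzC (interior_subset ho)
  · refine ⟨ρ γ z, ?_⟩
    refine interior_maximal (t := ρ γ '' (interior (f (some ⟨_, γ, rfl⟩)) ∩ C)) ?_
      ((ρ γ).toContinuousLinearEquiv.toHomeomorph.isOpenMap _ (isOpen_interior.inter hC))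
      ⟨z, ⟨ho, hzC⟩, rfl⟩
    rintro _ ⟨y, ⟨hy, hyC⟩, rfl⟩
    refine ⟨apply_mem_hull hA γ (hCA hyC), fun γ' => ?_⟩
    rw [← apply_mul_apply]
    exact interior_subset hy (γ' * γ)

/-- The excluded points lie on the kernels of the nonzero functionals ξ ∘ γ - ξ, of which there are
countably many; Baire again. -/
theorem dense_generic {ρ : Γ →* (V ≃ₗ[ℝ] V)} {ξ : V →ₗ[ℝ] ℝ} {L : Submodule ℤ V}
    (hL : Submodule.span ℝ (L : Set V) = ⊤) (hρL : ∀ γ, ∀ x ∈ L, ρ γ x ∈ L)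
    (hξL : ∀ x ∈ L, ∃ k : ℤ, ξ x = k) :
    Dense {y | ∀ γ, ξ (ρ γ y) = ξ y → ∀ x, ξ (ρ γ x) = ξ x} := by
  let S := (fun φ => φ - ξ) '' (Set.range fun γ => ξ ∘ₗ (ρ γ : V →ₗ[ℝ] V)) \ {0}
  have hS : S.Countable := ((countable_orbit_functional hL hρL hξL).image _).mono Set.sdiff_subset
  refine (dense_biInter_of_isOpen (S := S) (f := fun φ => {x | φ x ≠ 0})
    (fun φ _ => isOpen_ne_zero_functional φ) hS
    (fun φ hφ => dense_ne_zero_functional hφ.2)).mono fun y hy γ hγ => ?_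
  by_contra hne
  have hmem : ξ ∘ₗ (ρ γ : V →ₗ[ℝ] V) - ξ ∈ S := by
    refine ⟨⟨_, ⟨γ, rfl⟩, rfl⟩, fun h0 => hne fun x => ?_⟩
    simpa [sub_eq_zero] using LinearMap.congr_fun (Set.mem_singleton_iff.1 h0) x
  exact Set.mem_iInter₂.1 hy _ hmem (by simp [hγ])

/-- The Dirichlet cone is generated by finitely many lattice points. -/
theorem exists_finset_hull_eq_dirichletCone {ρ : Γ →* (V ≃ₗ[ℝ] V)} {ξ : V →ₗ[ℝ] ℝ}
    {L : Submodule ℤ V} (hL : Submodule.span ℝ (L : Set V) = ⊤)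
    (hρL : ∀ γ, ∀ x ∈ L, ρ γ x ∈ L) (hξL : ∀ x ∈ L, ∃ k : ℤ, ξ x = k)
    {A : Set V} (hAL : A ⊆ L) (hA : ∀ γ, ∀ x ∈ A, ρ γ x ∈ A) (hξA : ∀ x ∈ A, ∃ k : ℕ, ξ x = k)
    {C : Set V} (hC : IsOpen C) (hCne : C.Nonempty) (hAC : interior (hull ℝ A : Set V) ⊆ C)
    {W : Submodule ℝ V} (hρW : ∀ γ, ∀ x ∈ W, ρ γ x ∈ W) (hξW : ∀ x ∈ W, ξ x = 0)
    (hstab : ∀ γ, (∀ x, ξ (ρ γ x) = ξ x) → ∀ x, ρ γ x - x ∈ W)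
    {s : Finset V} (hsA : (s : Set V) ⊆ A) (hWs : (W : Set V) ⊆ hull ℝ (s : Set V))
    (hCs : C ⊆ ⋃ γ, ρ γ '' (hull ℝ (s : Set V) : Set V)) :
    ∃ r : Finset V, (r : Set V) ⊆ L ∧ hull ℝ (r : Set V) = dirichletCone ρ ξ (hull ℝ A) := by
  classical
  have hsK : hull ℝ (s : Set V) ≤ hull ℝ A := Submodule.span_mono hsA
  have hCA : C ⊆ hull ℝ A := by
    intro x hx
    obtain ⟨γ, y, hy, rfl⟩ := Set.mem_iUnion.1 (hCs hx)
    exact apply_mem_hull hA γ (hsK hy)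
  obtain ⟨F, hF⟩ := exists_finset_forall_exists_le (ρ := ρ) (ξ := ξ) (s := s)
    fun γ y hy => hξA _ (hA γ y (hsA hy))
  have hpiece : ∀ f : Γ, ∃ t : Finset V, (t : Set V) ⊆ L ∧ ∀ x, x ∈ hull ℝ (t : Set V) ↔
      x ∈ hull ℝ (s : Set V) ∧ ∀ g ∈ F, ξ (ρ f x) ≤ ξ (ρ g x) := by
    intro f
    obtain ⟨t, htL, ht⟩ := exists_finset_hull_inter_halfspaces (L := L) F
      (φ := fun g => ξ ∘ₗ (ρ g : V →ₗ[ℝ] V) - ξ ∘ₗ (ρ f : V →ₗ[ℝ] V))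
      (fun g x hx => by
        obtain ⟨k, hk⟩ := hξL _ (hρL g x hx)
        obtain ⟨l, hl⟩ := hξL _ (hρL f x hx)
        exact ⟨k - l, by simp [hk, hl]⟩) (hsA.trans hAL)
    exact ⟨t, htL, fun x => by simpa using ht x⟩
  choose t htL ht using hpiece
  let r : Finset V := F.biUnion fun f => (t f).image (ρ f)
  have hrL : (r : Set V) ⊆ L := by
    intro x hx
    obtain ⟨f, _, hx⟩ := Finset.mem_biUnion.1 hx
    obtain ⟨y, hy, rfl⟩ := Finset.mem_image.1 hx
    exact hρL f y (htL f hy)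
  have hmemr : ∀ f ∈ F, ∀ x ∈ hull ℝ (t f : Set V), ρ f x ∈ hull ℝ (r : Set V) := by
    intro f hf x hx
    induction hx using Submodule.span_induction with
    | mem x hx =>
      exact subset_hull (Finset.mem_biUnion.2 ⟨f, hf, Finset.mem_image_of_mem _ hx⟩)
    | zero => simp
    | add x y _ _ hx hy => rw [map_add]; exact add_mem hx hy
    | smul c x _ hx =>
      rw [← Nonneg.coe_smul, map_smul]
      exact smul_mem _ c.2 hx
  have hmemD : ∀ f, ∀ x ∈ hull ℝ (t f : Set V), ρ f x ∈ dirichletCone ρ ξ (hull ℝ A) := by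
    intro f x hx
    obtain ⟨hxs, hmin⟩ := (ht f x).1 hx
    refine ⟨apply_mem_hull hA f (hsK hxs), fun γ => ?_⟩
    obtain ⟨g, hg, h⟩ := hF (γ * f)
    rw [← apply_mul_apply]
    exact (hmin g hg).trans (h x hxs)
  -- On W all ξ ∘ g vanish, so the inequalities cutting out a piece are equalities there and every
  -- piece contains W.
  have hWr : (W : Set V) ⊆ hull ℝ (r : Set V) := by
    intro w hw
    obtain ⟨f, hf, _⟩ := hF 1
    rw [← apply_apply_inv ρ f w]
    have hw' := hρW f⁻¹ w hw
    refine hmemr f hf _ ((ht f _).2 ⟨hWs hw', fun g _ => ?_⟩)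
    rw [hξW _ (hρW _ _ hw'), hξW _ (hρW _ _ hw')]
  refine ⟨r, hrL, le_antisymm (Submodule.span_le.2 fun x hx => ?_) fun x hx => ?_⟩
  · obtain ⟨f, _, hx⟩ := Finset.mem_biUnion.1 hx
    obtain ⟨y, hy, rfl⟩ := Finset.mem_image.1 hx
    exact hmemD f y (subset_hull hy)
  · set D := dirichletCone ρ ξ (hull ℝ A)
    have hint : (interior (D : Set V)).Nonempty :=
      nonempty_interior_dirichletCone hL hρL hξL hA hξA hC hCne hCA
    have hgen : interior (D : Set V) ∩ {y | ∀ γ, ξ (ρ γ y) = ξ y → ∀ x, ξ (ρ γ x) = ξ x} ⊆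
        hull ℝ (r : Set V) := by
      rintro y ⟨hyint, hygen⟩
      have hyD : y ∈ D := interior_subset hyint
      have hyC : y ∈ C := hAC (interior_mono (fun z hz => hz.1) hyint)
      obtain ⟨γ, z, hz, rfl⟩ := Set.mem_iUnion.1 (hCs hyC)
      have hne : F.Nonempty := let ⟨f, hf, _⟩ := hF 1; ⟨f, hf⟩
      obtain ⟨f, hf, hmin⟩ := F.exists_min_image (fun f => ξ (ρ f z)) hne
      have hzt : z ∈ hull ℝ (t f : Set V) := (ht f z).2 ⟨hz, hmin⟩
      -- Both f z and y = γ z lie in D and in one orbit, so ξ agrees on them. As y is generic, f γ⁻¹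
      -- stabilizes ξ, and f z - y lies in W.
      have h₁ := (hmemD f z hzt).2 (γ * f⁻¹)
      have h₂ := hyD.2 (f * γ⁻¹)
      have h₃ : ρ (f * γ⁻¹) (ρ γ z) = ρ f z := by rw [apply_mul_apply, apply_inv_apply]
      rw [apply_mul_apply, apply_inv_apply] at h₁
      rw [h₃] at h₂
      have h₄ := hstab _ (hygen (f * γ⁻¹) (by rw [h₃]; exact le_antisymm h₁ h₂)) (ρ γ z)
      rw [h₃] at h₄
      have h₅ := add_mem (hmemr f hf z hzt) (hWr (W.neg_mem h₄))
      simpa using h₅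
    have hsub : interior (D : Set V) ⊆ hull ℝ (r : Set V) := by
      refine ((dense_generic hL hρL hξL).open_subset_closure_inter isOpen_interior).trans ?_
      exact (isClosed_hull_finset r).closure_subset_iff.2 hgen
    have := (isClosed_hull_finset r).closure_subset_iff.2 hsub
    rw [(D.convex).closure_interior_eq_closure_of_nonempty_interior hint] at this
    exact this (subset_closure hx)

end Polyhedral

/-! ### Commensurable lattices and rational subspaces -/

section Rationality

variable {V : Type*} [NormedAddCommGroup V] [NormedSpace ℝ V] [FiniteDimensional ℝ V]

/-- The coordinates of the lattice points with respect to a basis made of lattice points have a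
common denominator. -/
theorem exists_common_denominator (L : Submodule ℤ V) [DiscreteTopology L] [IsZLattice ℝ L]
    {ι : Type*} [Finite ι] (b : Module.Basis ι ℝ V) (hb : ∀ i, b i ∈ L) :
    ∃ d : ℕ, 0 < d ∧ ∀ x ∈ L, ∀ i, ∃ k : ℤ, (d : ℝ) * b.repr x i = k := by
  classical
  have : Fintype ι := Fintype.ofFinite ι
  have := ZLattice.module_free ℝ L
  have := ZLattice.module_finite ℝ L
  let e₀ := Module.Free.chooseBasis ℤ L
  let σ := (e₀.ofZLatticeBasis ℝ L).indexEquiv b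
  let e := (e₀.ofZLatticeBasis ℝ L).reindex σ
  have he : ∀ x ∈ L, ∀ i, ∃ k : ℤ, e.repr x i = k := fun x hx i =>
    ⟨e₀.repr ⟨x, hx⟩ (σ.symm i), by
      rw [Module.Basis.repr_reindex_apply]
      exact Module.Basis.ofZLatticeBasis_repr_apply ℝ L e₀ ⟨x, hx⟩ _⟩
  choose! k hk using he
  let M : Matrix ι ι ℤ := Matrix.of fun i j => k (b j) i
  have hM : (Int.castRingHom ℝ).mapMatrix M = e.toMatrix b := by
    ext i j
    simp [M, Module.Basis.toMatrix_apply, hk (b j) (hb j)]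
  have hdet : ((M.det : ℤ) : ℝ) = (e.toMatrix b).det := by
    rw [← hM, ← RingHom.map_det]; rfl
  have hdet0 : M.det ≠ 0 := by
    intro h
    rw [h, Int.cast_zero] at hdet
    have := congrArg Matrix.det (e.toMatrix_mul_toMatrix_flip b)
    rw [Matrix.det_mul, ← hdet, zero_mul, Matrix.det_one] at this
    exact zero_ne_one this
  -- Cramer's rule: b has an integer matrix M in a lattice basis e, and det M · M⁻¹ is the integer
  -- adjugate, so |det M| is a common denominator.
  have hadj : (e.toMatrix b).adjugate = (e.toMatrix b).det • b.toMatrix e := by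
    calc (e.toMatrix b).adjugate
        = (e.toMatrix b).adjugate * (e.toMatrix b * b.toMatrix e) := by
          rw [e.toMatrix_mul_toMatrix_flip b, mul_one]
      _ = _ := by rw [← mul_assoc, Matrix.adjugate_mul, Matrix.smul_mul, one_mul]
  have key : ∀ x ∈ L, ∀ i, ∃ l : ℤ, (M.det : ℝ) * b.repr x i = l := by
    intro x hx i
    refine ⟨∑ j, M.adjugate i j * k x j, ?_⟩
    rw [hdet, ← congrFun (e.toMatrix_mulVec_repr b x) i, ← smul_eq_mul, ← Pi.smul_apply,
      ← Matrix.smul_mulVec, ← hadj, ← hM, ← RingHom.map_adjugate]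
    simp [Matrix.mulVec, dotProduct, hk x hx]
  refine ⟨M.det.natAbs, Int.natAbs_pos.2 hdet0, fun x hx i => ?_⟩
  obtain ⟨l, hl⟩ := key x hx i
  rw [Nat.cast_natAbs, Int.cast_abs]
  rcases abs_choice (M.det : ℝ) with h | h <;> rw [h]
  · exact ⟨l, hl⟩
  · exact ⟨-l, by rw [neg_mul, hl, Int.cast_neg]⟩

/-- L ∩ VZ contains a basis of V, and a common denominator d of VZ in this basis gives d • VZ ⊆ L.
-/
theorem ratPoints_subset_ratPoints {VZ L : Submodule ℤ V} [DiscreteTopology VZ] [IsZLattice ℝ VZ]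
    (hL : Submodule.span ℝ (L : Set V) = ⊤) (hLV : (L : Set V) ⊆ ratPoints VZ) :
    ratPoints VZ ⊆ ratPoints L := by
  have hspan : ⊤ ≤ Submodule.span ℝ ((L : Set V) ∩ VZ) := by
    rw [← hL, Submodule.span_le]
    intro x hx
    obtain ⟨n, hn, hnx⟩ := hLV hx
    have h : (n : ℝ)⁻¹ • (n • x) ∈ Submodule.span ℝ ((L : Set V) ∩ VZ) :=
      Submodule.smul_mem _ _ (Submodule.subset_span ⟨L.toAddSubgroup.nsmul_mem hx n, hnx⟩)
    rwa [← Nat.cast_smul_eq_nsmul ℝ, inv_smul_smul₀ (by positivity)] at h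
  let b := Module.Basis.ofSpan hspan
  have hb : ∀ i, b i ∈ (L : Set V) ∩ VZ := fun i => Module.Basis.ofSpan_subset hspan ⟨i, rfl⟩
  have := Module.Finite.finite_basis b
  have := Fintype.ofFinite
    ↑((linearIndepOn_empty ℝ (id : V → V)).extend (Set.empty_subset ((L : Set V) ∩ VZ)))
  obtain ⟨d, hd, h⟩ := exists_common_denominator VZ b fun i => (hb i).2
  rintro x ⟨n, hn, hnx⟩
  refine ⟨d * n, Nat.mul_pos hd hn, ?_⟩
  choose k hk using h _ hnx
  have : (d * n) • x = ∑ i, k i • b i := by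
    rw [mul_smul, ← Nat.cast_smul_eq_nsmul ℝ d, ← b.sum_repr (n • x), Finset.smul_sum]
    refine Finset.sum_congr rfl fun i _ => ?_
    rw [smul_smul, hk, Int.cast_smul_eq_zsmul]
  rw [this]
  exact sum_mem fun i _ => L.smul_mem _ (hb i).1

/-- Integral linear equations of a rational subspace. -/
theorem exists_integral_equations (L : Submodule ℤ V) [DiscreteTopology L] [IsZLattice ℝ L]
    {W : Submodule ℝ V} (hW : Submodule.span ℝ ((W : Set V) ∩ L) = W) :
    ∃ (m : ℕ) (ζ : Fin m → V →ₗ[ℝ] ℝ), (∀ j, ∀ x ∈ L, ∃ k : ℤ, ζ j x = k) ∧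
      (∀ x, x ∈ W ↔ ∀ j, ζ j x = 0) ∧ ∀ a : Fin m → ℝ, ∃ x, ∀ j, ζ j x = a j := by
  classical
  obtain ⟨t, htW, htspan, hli⟩ := exists_linearIndependent ℝ ((W : Set V) ∩ L)
  rw [hW] at htspan
  have htL : t ⊆ (L : Set V) := fun x hx => (htW hx).2
  have hli' : LinearIndepOn ℝ id t := hli
  have hL : ⊤ ≤ Submodule.span ℝ (L : Set V) := IsZLattice.span_top.ge
  let b := Module.Basis.extendLe hli' htL hL
  have hbapp : ∀ i, b i = i := fun i => Module.Basis.extendLe_apply_self hli' htL hL i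
  have hb : ∀ i, b i ∈ L := fun i => by
    rw [hbapp]; exact hli'.extend_subset htL i.2
  have hfin := Module.Finite.finite_basis b
  obtain ⟨d, hd, hint⟩ := exists_common_denominator L b hb
  have hd' : (d : ℝ) ≠ 0 := by positivity
  -- A basis of W made of lattice points is extended by lattice points to a basis of V. The
  -- coordinates along the added vectors, times d, are the equations.
  let J := {i : hli'.extend htL // i.1 ∉ t}
  have : Fintype J := Fintype.ofFinite J
  let σ : Fin (Fintype.card J) ≃ J := (Fintype.equivFin J).symm
  refine ⟨Fintype.card J, fun j => (d : ℝ) • b.coord (σ j).1, fun j x hx => ?_, fun x => ?_,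
    fun a => ?_⟩
  · simpa using hint x hx (σ j).1
  · have himage : b '' {i | i.1 ∈ t} = t := by
      ext y
      constructor
      · rintro ⟨i, hi, rfl⟩
        rw [hbapp]; exact hi
      · intro hy
        exact ⟨⟨y, hli'.subset_extend htL hy⟩, hy, hbapp _⟩
    have hWb : Submodule.span ℝ (b '' {i | i.1 ∈ t}) = W := by rw [himage, htspan]
    rw [← hWb, b.mem_span_image]
    constructor
    · intro h j
      have : b.repr x (σ j).1 = 0 := by
        by_contra hne
        exact (σ j).2 (h (Finsupp.mem_support_iff.2 hne))
      simp [this]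
    · intro h i hi
      by_contra hne
      have := h (σ.symm ⟨i, hne⟩)
      simp only [Equiv.apply_symm_apply, LinearMap.smul_apply, Module.Basis.coord_apply,
        smul_eq_mul, mul_eq_zero, hd', false_or] at this
      exact (Finsupp.mem_support_iff.1 hi) this
  · refine ⟨∑ l, ((d : ℝ)⁻¹ * a l) • b (σ l).1, fun j => ?_⟩
    have : ∀ l, (Finsupp.single (σ l).1 (1 : ℝ)) (σ j).1 = if l = j then 1 else 0 := fun l => by
      rw [Finsupp.single_apply]
      simp [Subtype.val_inj]
    simp only [map_sum, map_smul, LinearMap.smul_apply, Module.Basis.coord_apply,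
      Module.Basis.repr_self, this, smul_eq_mul, mul_ite, mul_one, mul_zero, Finset.sum_ite_eq',
      Finset.mem_univ, if_true]
    field_simp

end Rationality

/-! ### The dual cone and the maximal subspace -/

section DualCone

variable {V : Type*} [NormedAddCommGroup V] [NormedSpace ℝ V]

theorem zero_mem_closure_cone {C : ConvexCone ℝ V} (hCne : (C : Set V).Nonempty) :
    (0 : V) ∈ closure (C : Set V) :=
  ConvexCone.Pointed.of_nonempty_of_isClosed (C := C.closure) (hCne.mono subset_closure)
    isClosed_closure

theorem smul_mem_closure_cone {C : ConvexCone ℝ V} (hCne : (C : Set V).Nonempty) {t : ℝ}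
    (ht : 0 ≤ t) {x : V} (hx : x ∈ closure (C : Set V)) : t • x ∈ closure (C : Set V) := by
  rcases ht.eq_or_lt with rfl | ht
  · rw [zero_smul]; exact zero_mem_closure_cone hCne
  · exact C.closure.smul_mem ht hx

theorem add_mem_closure_cone {C : ConvexCone ℝ V} {x y : V} (hx : x ∈ closure (C : Set V))
    (hy : y ∈ closure (C : Set V)) : x + y ∈ closure (C : Set V) :=
  C.closure.add_mem hx hy

theorem functional_eq_zero_of_mem_subspace {s : Set V} {W : Submodule ℝ V} (hW : (W : Set V) ⊆ s)
    {ξ : V →ₗ[ℝ] ℝ} (hξ : ∀ x ∈ s, 0 ≤ ξ x) {x : V} (hx : x ∈ W) : ξ x = 0 := by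
  have h₁ := hξ x (hW hx)
  have h₂ := hξ (-x) (hW (W.neg_mem hx))
  rw [map_neg] at h₂
  linarith

/-- The maximal subspace in the closure of a cone is the annihilator of the dual cone. -/
theorem mem_maximalSubspace_of_forall_eq_zero {C : ConvexCone ℝ V} (hCne : (C : Set V).Nonempty)
    {W : Submodule ℝ V} (hW : IsMaximalSubspace (C : Set V) W) {x : V}
    (hx : ∀ ξ : V →ₗ[ℝ] ℝ, (∀ y ∈ closure (C : Set V), 0 ≤ ξ y) → ξ x = 0) : x ∈ W := by
  let K : ProperCone ℝ V :=
    { C.closure.toPointedCone (zero_mem_closure_cone hCne) with isClosed' := isClosed_closure }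
  have hK : ∀ z : V, (∀ ξ : V →ₗ[ℝ] ℝ, (∀ y ∈ closure (C : Set V), 0 ≤ ξ y) → ξ z = 0) →
      z ∈ closure (C : Set V) := by
    intro z hz
    by_contra hne
    obtain ⟨f, hf, hfz⟩ := ProperCone.hyperplane_separation_point K (x₀ := z) hne
    exact hfz.ne (hz f.toLinearMap hf)
  have hneg := hK (-x) fun ξ hξ => by rw [map_neg, hx ξ hξ, neg_zero]
  have hle : Submodule.span ℝ {x} ≤ W := by
    refine hW.2 fun y hy => ?_
    obtain ⟨t, rfl⟩ := Submodule.mem_span_singleton.1 hy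
    rcases le_total 0 t with ht | ht
    · exact smul_mem_closure_cone hCne ht (hK x hx)
    · have := smul_mem_closure_cone hCne (neg_nonneg.2 ht) hneg
      rwa [neg_smul_neg] at this
  exact hle (Submodule.mem_span_singleton_self x)

/-- With respect to linear equations of the maximal subspace, the dual cone has interior points. -/
theorem nonempty_interior_dual {C : ConvexCone ℝ V} (hCne : (C : Set V).Nonempty)
    {W : Submodule ℝ V} (hW : IsMaximalSubspace (C : Set V) W) {m : ℕ} {ζ : Fin m → V →ₗ[ℝ] ℝ}
    (hζW : ∀ x, x ∈ W ↔ ∀ j, ζ j x = 0) (hζ : ∀ a : Fin m → ℝ, ∃ x, ∀ j, ζ j x = a j) :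
    (interior {c : Fin m → ℝ | ∀ x ∈ closure (C : Set V), 0 ≤ ∑ j, c j * ζ j x}).Nonempty := by
  set S := {c : Fin m → ℝ | ∀ x ∈ closure (C : Set V), 0 ≤ ∑ j, c j * ζ j x}
  have hconv : Convex ℝ S := by
    intro c hc c' hc' u v hu hv _ x hx
    have := add_nonneg (mul_nonneg hu (hc x hx)) (mul_nonneg hv (hc' x hx))
    rw [Finset.mul_sum, Finset.mul_sum, ← Finset.sum_add_distrib] at this
    convert! this using 2 with j
    simp only [Pi.add_apply, Pi.smul_apply, smul_eq_mul]
    ring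
  have h0 : (0 : Fin m → ℝ) ∈ S := fun x _ => by simp
  rw [hconv.interior_nonempty_iff_affineSpan_eq_top]
  apply SetLike.coe_injective
  rw [← Set.insert_eq_of_mem h0, affineSpan_insert_zero, AffineSubspace.top_coe]
  by_contra hne
  have hlt : Submodule.span ℝ S < ⊤ := lt_top_iff_ne_top.2 fun h => hne (by rw [h]; rfl)
  -- If the dual cone spanned a proper subspace, some f ≠ 0 would vanish on it. Realizing f as
  -- evaluation at a vector x, all dual functionals kill x, so x ∈ W and f = 0.
  obtain ⟨f, hf, hker⟩ := Submodule.exists_le_ker_of_lt_top _ hlt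
  have hfc : ∀ c, f c = ∑ j, c j * f (Pi.single j 1) := fun c => by
    conv_lhs => rw [pi_eq_sum_univ' c]
    simp
  obtain ⟨x, hx⟩ := hζ fun j => f (Pi.single j 1)
  choose v hv using fun i : Fin m => hζ (Pi.single i 1)
  have hxW : x ∈ W := by
    refine mem_maximalSubspace_of_forall_eq_zero hCne hW fun ξ hξ => ?_
    -- ξ vanishes on W, so it is a combination of the equations of W; the v j are dual vectors for
    -- them.
    have hexp : ∀ y, ξ y = ∑ j, ξ (v j) * ζ j y := by
      intro y
      have hyW : y - ∑ i, ζ i y • v i ∈ W := by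
        rw [hζW]
        intro j
        simp [hv, Pi.single_apply]
      have := functional_eq_zero_of_mem_subspace hW.1 hξ hyW
      rw [map_sub, map_sum, sub_eq_zero] at this
      rw [this]
      simp [mul_comm]
    have hmem : (fun j => ξ (v j)) ∈ S := fun y hy => by
      rw [← hexp]; exact hξ y hy
    have := hker (Submodule.subset_span hmem)
    rw [LinearMap.mem_ker, hfc] at this
    rw [hexp, ← this]
    simp [hx]
  refine hf (LinearMap.ext fun c => ?_)
  rw [hfc]
  simp [← hx, (hζW x).1 hxW]

end DualCone

/-! ### A functional with small stabilizer -/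

section Stabilizer

variable {V : Type*} [NormedAddCommGroup V] [NormedSpace ℝ V] [FiniteDimensional ℝ V]
  {Γ : Type*} [Group Γ]

/-- An open set of `ℝᵐ` contains a rational point which is not orthogonal to any of finitely many
nonzero vectors. -/
theorem exists_rat_mem_forall_sum_ne_zero {m : ℕ} {O : Set (Fin m → ℝ)} (hO : IsOpen O)
    (hne : O.Nonempty) {S : Set (Fin m → ℤ)} (hS : S.Finite) :
    ∃ q : Fin m → ℚ, (fun j => (q j : ℝ)) ∈ O ∧
      ∀ d ∈ S, ∑ j, (q j : ℝ) * d j = 0 → d = 0 := by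
  let φ : (Fin m → ℤ) → (Fin m → ℝ) →ₗ[ℝ] ℝ := fun d => ∑ j, (d j : ℝ) • LinearMap.proj j
  have hφ : ∀ d c, φ d c = ∑ j, c j * d j := fun d c => by
    simp [φ, mul_comm]
  have hφ0 : ∀ d, d ≠ 0 → φ d ≠ 0 := by
    intro d hd h
    refine hd (funext fun j => ?_)
    have := LinearMap.congr_fun h (Pi.single j 1)
    rw [hφ] at this
    simpa [Pi.single_apply] using this
  have hdense : Dense (⋂ d ∈ S \ {0}, {c | φ d c ≠ 0}) :=
    dense_biInter_of_isOpen (fun d _ => isOpen_ne_zero_functional _)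
      (hS.subset Set.sdiff_subset).countable fun d hd => dense_ne_zero_functional (hφ0 d hd.2)
  have hopen : IsOpen (⋂ d ∈ S \ {0}, {c | φ d c ≠ 0}) :=
    (hS.subset Set.sdiff_subset).isOpen_biInter fun d _ => isOpen_ne_zero_functional _
  have hq : DenseRange (Pi.map fun (_ : Fin m) (q : ℚ) => (q : ℝ)) :=
    DenseRange.piMap fun _ => Rat.denseRange_cast
  obtain ⟨q, hqO, hqS⟩ := hq.exists_mem_open (hO.inter hopen) (hdense.inter_open_nonempty O hO hne)
  refine ⟨q, hqO, fun d hd hsum => ?_⟩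
  by_contra hd0
  exact Set.mem_iInter₂.1 hqS d ⟨hd, hd0⟩ (by rw [hφ]; exact hsum)

/-- There is an integral functional in the dual cone whose stabilizer acts trivially modulo the
maximal subspace. -/
theorem exists_integral_functional {L : Submodule ℤ V} [DiscreteTopology L] [IsZLattice ℝ L]
    {ρ : Γ →* (V ≃ₗ[ℝ] V)} (hρL : ∀ γ, ∀ x ∈ L, ρ γ x ∈ L)
    {C : ConvexCone ℝ V} (hCne : (C : Set V).Nonempty)
    (hρC : ∀ γ, ∀ x ∈ closure (C : Set V), ρ γ x ∈ closure (C : Set V))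
    (hspan : Submodule.span ℝ (closure (C : Set V) ∩ L) = ⊤)
    {W : Submodule ℝ V} (hW : IsMaximalSubspace (C : Set V) W)
    (hWL : Submodule.span ℝ ((W : Set V) ∩ L) = W) :
    ∃ ξ : V →ₗ[ℝ] ℝ, (∀ x ∈ L, ∃ k : ℤ, ξ x = k) ∧ (∀ x ∈ closure (C : Set V), 0 ≤ ξ x) ∧
      ∀ γ, (∀ x, ξ (ρ γ x) = ξ x) → ∀ x, ρ γ x - x ∈ W := by
  obtain ⟨m, ζ, hζL, hζW, hζ⟩ := exists_integral_equations L hWL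
  obtain ⟨c₀, hc₀⟩ := nonempty_interior_dual hCne hW hζW hζ
  obtain ⟨R, hR, hball⟩ := Metric.mem_nhds_iff.1 (mem_interior_iff_mem_nhds.1 hc₀)
  -- Halving the radius lets any coefficient of a c in the smaller ball move by up to r within the
  -- dual cone. This yields `hbound`.
  let r := R / 2
  have hr : 0 < r := half_pos hR
  let b := Module.Basis.ofSpan hspan.ge
  have hb : ∀ i, b i ∈ closure (C : Set V) ∩ L := fun i =>
    Module.Basis.ofSpan_subset hspan.ge ⟨i, rfl⟩
  have := Module.Finite.finite_basis b
  obtain ⟨M, hM⟩ : ∃ M : ℝ, ∀ i, ∀ c ∈ Metric.ball c₀ r, ∑ j, c j * ζ j (b i) ≤ M := by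
    have h : ∀ i, ∃ M : ℝ, ∀ c ∈ Metric.ball c₀ r, ∑ j, c j * ζ j (b i) ≤ M := by
      intro i
      refine ⟨∑ j, (|c₀ j| + r) * |ζ j (b i)|, fun c hc => Finset.sum_le_sum fun j _ => ?_⟩
      refine (le_abs_self _).trans ?_
      rw [abs_mul]
      refine mul_le_mul_of_nonneg_right ?_ (abs_nonneg _)
      have h₁ : dist (c j) (c₀ j) < r := (dist_le_pi_dist c c₀ j).trans_lt hc
      rw [Real.dist_eq] at h₁
      have := abs_sub_abs_le_abs_sub (c j) (c₀ j)
      linarith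
    choose M hM using h
    obtain ⟨N, hN⟩ := (Set.finite_range M).bddAbove
    exact ⟨N, fun i c hc => (hM i c hc).trans (hN ⟨i, rfl⟩)⟩
  have hbound : ∀ c ∈ Metric.ball c₀ r, ∀ y ∈ closure (C : Set V), ∀ j,
      r * |ζ j y| ≤ ∑ l, c l * ζ l y := by
    intro c hc y hy j
    have hshift : ∀ t : ℝ, |t| ≤ r → 0 ≤ (∑ l, c l * ζ l y) + t * ζ j y := by
      intro t ht
      have hmem : c + Pi.single j t ∈ Metric.ball c₀ R := by
        have h₁ : dist (c + Pi.single j t) c ≤ r := by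
          rw [dist_eq_norm, add_sub_cancel_left, Pi.norm_single]
          exact ht
        have h₂ : dist c c₀ < r := hc
        have h₃ : r + r = R := add_halves R
        exact (dist_triangle _ c _).trans_lt (by linarith)
      have := hball hmem y hy
      simpa [add_mul, Finset.sum_add_distrib, Pi.single_apply] using this
    have h₁ := hshift r (abs_of_pos hr).le
    have h₂ := hshift (-r) (by rw [abs_neg, abs_of_pos hr])
    rcases abs_choice (ζ j y) with h | h <;> rw [h] <;> linarith
  -- If γ fixes η, then each ζ j is at most M / r in absolute value at both b i and γ (b i). Their
  -- differences form an integer vector in the box of size N, and q is chosen orthogonal to no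
  -- nonzero vector of that box.
  obtain ⟨N, hN⟩ := exists_nat_gt (2 * M / r)
  obtain ⟨q, hq, hqne⟩ := exists_rat_mem_forall_sum_ne_zero Metric.isOpen_ball
    ⟨c₀, Metric.mem_ball_self hr⟩ (Set.finite_Icc (fun _ : Fin m => -(N : ℤ)) fun _ => N)
  -- Clears the denominators of q; scaling by n does not change the stabilizer.
  let n : ℕ := ∏ j, (q j).den
  have hn : 0 < n := Finset.prod_pos fun j _ => (q j).den_pos
  have hn' : (0 : ℝ) < n := Nat.cast_pos.2 hn
  let η : V →ₗ[ℝ] ℝ := ∑ j, (q j : ℝ) • ζ j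
  have hη : ∀ x, η x = ∑ j, (q j : ℝ) * ζ j x := fun x => by simp [η]
  refine ⟨(n : ℝ) • η, fun x hx => ?_, fun x hx => ?_, fun γ hγ => ?_⟩
  · choose k hk using fun j => hζL j x hx
    have hden : ∀ j, ∃ a : ℤ, (n : ℝ) * q j = a := by
      intro j
      obtain ⟨e, he⟩ := Finset.dvd_prod_of_mem (fun j => (q j).den) (Finset.mem_univ j)
      refine ⟨(q j).num * e, ?_⟩
      have h₁ : (n : ℚ) * q j = (q j).num * e := by
        rw [show n = (q j).den * e from he, Nat.cast_mul, mul_right_comm, mul_comm ((q j).den : ℚ),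
          Rat.mul_den_eq_num]
      exact_mod_cast congrArg (Rat.cast : ℚ → ℝ) h₁
    choose a ha using hden
    refine ⟨∑ j, a j * k j, ?_⟩
    rw [LinearMap.smul_apply, hη, smul_eq_mul, Finset.mul_sum, Int.cast_sum]
    refine Finset.sum_congr rfl fun j _ => ?_
    rw [← mul_assoc, ha, hk, Int.cast_mul]
  · rw [LinearMap.smul_apply, hη]
    refine mul_nonneg hn'.le (hball (Metric.ball_subset_ball (half_le_self hR.le) hq) x hx)
  · have hγ' : ∀ x, η (ρ γ x) = η x := fun x => by
      simpa [hn'.ne'] using hγ x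
    have hbW : ∀ i, ρ γ (b i) - b i ∈ W := by
      intro i
      choose k hk using fun j => hζL j _ (hρL γ _ (hb i).2)
      choose l hl using fun j => hζL j _ (hb i).2
      have hMi := hM i _ hq
      have hdiff : ∀ j, |((k j - l j : ℤ) : ℝ)| ≤ N := by
        intro j
        have h₁ := hbound _ hq _ (hρC γ _ (hb i).1) j
        have h₂ := hbound _ hq _ (hb i).1 j
        rw [← hη, hγ', hη] at h₁
        have h₃ := abs_sub (ζ j (ρ γ (b i))) (ζ j (b i))
        rw [Int.cast_sub, ← hk, ← hl]
        refine le_trans ?_ hN.le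
        rw [le_div_iff₀ hr]
        nlinarith
      have hzero : (fun j => k j - l j) = 0 := by
        refine hqne _ ⟨fun j => ?_, fun j => ?_⟩ ?_
        · have := (abs_le.1 (hdiff j)).1
          exact_mod_cast this
        · have := (abs_le.1 (hdiff j)).2
          exact_mod_cast this
        · have := sub_eq_zero.2 (hγ' (b i))
          rw [hη, hη, ← Finset.sum_sub_distrib] at this
          rw [← this]
          refine Finset.sum_congr rfl fun j _ => ?_
          rw [hk, hl, Int.cast_sub]
          ring
      rw [hζW]
      intro j
      rw [map_sub, hk, hl, ← Int.cast_sub, show k j - l j = 0 from congrFun hzero j, Int.cast_zero]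
    have h0 : W.mkQ ∘ₗ ((ρ γ : V →ₗ[ℝ] V) - LinearMap.id) = 0 :=
      b.ext fun i => by
        simpa using (Submodule.Quotient.mk_eq_zero W).2 (hbW i)
    intro x
    rw [← Submodule.Quotient.mk_eq_zero W]
    simpa using LinearMap.congr_fun h0 x

end Stabilizer

/-! ### Generators of C₊ and lifting from V/W -/

section Reduction

variable {V : Type*} [NormedAddCommGroup V] [NormedSpace ℝ V]

theorem smul_mem_convexHull_of_nsmul_mem {B : Set V} (h0 : (0 : V) ∈ B)
    (hB : ∀ n : ℕ, ∀ x ∈ B, n • x ∈ B) {c : ℝ} (hc : 0 ≤ c) {x : V} (hx : x ∈ convexHull ℝ B) :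
    c • x ∈ convexHull ℝ B := by
  obtain ⟨n, hn⟩ := exists_nat_gt c
  have hn0 : (0 : ℝ) < n := hc.trans_lt hn
  have hnx : (n : ℝ) • x ∈ convexHull ℝ B := by
    have hmaps : convexHull ℝ B ⊆
        ((n : ℝ) • LinearMap.id (R := ℝ) (M := V)) ⁻¹' convexHull ℝ B :=
      convexHull_min (fun y hy => subset_convexHull ℝ B (by
        simpa [Nat.cast_smul_eq_nsmul] using hB n y hy)) ((convex_convexHull ℝ B).linear_preimage _)
    exact hmaps hx
  -- c • x is the multiple c / n ≤ 1 of n • x, hence on the segment from 0 to n • x.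
  have := (convex_convexHull ℝ B).smul_mem_of_zero_mem (subset_convexHull ℝ B h0) hnx
    (t := c / n) ⟨div_nonneg hc hn0.le, (div_le_one hn0).2 hn.le⟩
  rwa [smul_smul, div_mul_cancel₀ _ hn0.ne'] at this

theorem nsmul_mem_ratPoints {E : Type*} [AddCommGroup E] {L : Submodule ℤ E} {x : E}
    (hx : x ∈ ratPoints L) (n : ℕ) : n • x ∈ ratPoints L := by
  obtain ⟨k, hk, h⟩ := hx
  exact ⟨k, hk, by rw [smul_comm]; exact L.toAddSubgroup.nsmul_mem h n⟩

/-- A rational point of the closure of a cone is a multiple of a lattice point of it. -/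
theorem mem_hull_of_mem_ratPoints {L : Submodule ℤ V} {C : ConvexCone ℝ V}
    (hCne : (C : Set V).Nonempty) {x : V} (hx : x ∈ closure (C : Set V)) (hxL : x ∈ ratPoints L) :
    x ∈ hull ℝ (closure (C : Set V) ∩ L) := by
  obtain ⟨n, hn, hnx⟩ := hxL
  have hn' : (0 : ℝ) < n := Nat.cast_pos.2 hn
  rw [← smul_mem_iff _ hn']
  refine subset_hull ⟨smul_mem_closure_cone hCne hn'.le hx, ?_⟩
  rwa [Nat.cast_smul_eq_nsmul]

theorem conePlus_eq_hull {VZ L : Submodule ℤ V} (hLV : (L : Set V) ⊆ ratPoints VZ)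
    (hVL : ratPoints VZ ⊆ ratPoints L) {C : ConvexCone ℝ V} (hCne : (C : Set V).Nonempty) :
    conePlus VZ (C : Set V) = hull ℝ (closure (C : Set V) ∩ L) := by
  refine subset_antisymm (convexHull_min (fun x hx =>
    mem_hull_of_mem_ratPoints hCne hx.1 (hVL hx.2)) (hull ℝ _).convex) fun x hx => ?_
  have h0 : (0 : V) ∈ closure (C : Set V) ∩ ratPoints VZ :=
    ⟨zero_mem_closure_cone hCne, 1, one_pos, by simp⟩
  have hsmul : ∀ c : ℝ, 0 ≤ c → ∀ x ∈ conePlus VZ (C : Set V), c • x ∈ conePlus VZ (C : Set V) :=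
    fun c hc x hx => smul_mem_convexHull_of_nsmul_mem h0 (fun n y hy =>
      ⟨by
        rw [← Nat.cast_smul_eq_nsmul ℝ]
        exact smul_mem_closure_cone hCne (Nat.cast_nonneg n) hy.1,
        nsmul_mem_ratPoints hy.2 n⟩) hc hx
  induction hx using Submodule.span_induction with
  | mem x hx => exact subset_convexHull ℝ _ ⟨hx.1, hLV hx.2⟩
  | zero => exact subset_convexHull ℝ _ h0
  | add x y _ _ hx hy =>
    have := convex_convexHull ℝ (closure (C : Set V) ∩ ratPoints VZ) hx hy
      (a := 1 / 2) (b := 1 / 2) (by norm_num) (by norm_num) (by norm_num)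
    convert! hsmul 2 zero_le_two _ this using 1
    module
  | smul c x _ hx => exact hsmul c c.2 x hx

/-- The preimage of the image of C is C + W, which lies in the closure of C; the quotient map is
open, so closures pull back. -/
theorem mem_closure_of_mkQ_mem_closure {C : ConvexCone ℝ V} {W : Submodule ℝ V}
    (hW : (W : Set V) ⊆ closure (C : Set V)) {x : V}
    (hx : W.mkQ x ∈ closure (W.mkQ '' (C : Set V))) : x ∈ closure (C : Set V) := by
  have h := W.isOpenMap_mkQ.preimage_closure_subset_closure_preimage hx
  refine closure_minimal ?_ isClosed_closure h
  rintro y ⟨c, hc, hcy⟩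
  have hyc : y - c ∈ W := by
    rw [← Submodule.Quotient.mk_eq_zero W, Submodule.Quotient.mk_sub, sub_eq_zero]
    exact hcy.symm
  have := add_mem_closure_cone (subset_closure hc) (hW hyc)
  rwa [add_sub_cancel] at this

theorem hull_image_mkQ (W : Submodule ℝ V) (A : Set V) :
    (hull ℝ (W.mkQ '' A) : Set (V ⧸ W)) = W.mkQ '' (hull ℝ A : Set V) := by
  have := Submodule.map_span (W.mkQ.restrictScalars {c : ℝ // 0 ≤ c}) A
  exact (congrArg (fun S : PointedCone ℝ (V ⧸ W) => (S : Set (V ⧸ W))) this).symm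

theorem conePlus_quotient_subset {VZ L : Submodule ℤ V} (hVL : ratPoints VZ ⊆ ratPoints L)
    {C : ConvexCone ℝ V} (hCne : (C : Set V).Nonempty) {W : Submodule ℝ V}
    (hW : (W : Set V) ⊆ closure (C : Set V)) :
    conePlus (quotientLattice VZ W) (W.mkQ '' (C : Set V)) ⊆
      W.mkQ '' (hull ℝ (closure (C : Set V) ∩ L) : Set V) := by
  refine convexHull_min ?_ ((hull ℝ _).convex.linear_image _)
  rintro y ⟨hy, n, hn, l, hl, hly⟩
  have hn' : (n : ℝ) ≠ 0 := Nat.cast_ne_zero.2 hn.ne'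
  have hxy : W.mkQ ((n : ℝ)⁻¹ • l) = y := by
    have hly' : W.mkQ l = n • y := hly
    rw [map_smul, hly', ← Nat.cast_smul_eq_nsmul ℝ, inv_smul_smul₀ hn']
  refine ⟨(n : ℝ)⁻¹ • l, mem_hull_of_mem_ratPoints hCne ?_ (hVL ⟨n, hn, ?_⟩), hxy⟩
  · exact mem_closure_of_mkQ_mem_closure hW (by rwa [hxy])
  · rwa [← Nat.cast_smul_eq_nsmul ℝ, smul_inv_smul₀ hn']

theorem exists_finset_subset_hull {A : Set V} (t : Finset V) (ht : (t : Set V) ⊆ hull ℝ A) :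
    ∃ s : Finset V, (s : Set V) ⊆ A ∧ (t : Set V) ⊆ hull ℝ (s : Set V) := by
  classical
  choose! T hTA hT using fun x (hx : x ∈ t) => Submodule.mem_span_finite_of_mem_span (ht hx)
  refine ⟨t.biUnion T, fun y hy => ?_, fun x hx => ?_⟩
  · obtain ⟨x, hx, hy⟩ := Finset.mem_biUnion.1 hy
    exact hTA x hx hy
  · exact Submodule.span_mono (fun y hy => Finset.mem_biUnion.2 ⟨x, hx, hy⟩) (hT x hx)

theorem span_subset_hull_of_neg_mem {s : Set V} (hs : ∀ x ∈ s, -x ∈ s) :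
    (Submodule.span ℝ s : Set V) ⊆ hull ℝ s := by
  have hneg : ∀ x ∈ hull ℝ s, -x ∈ hull ℝ s := by
    intro x hx
    induction hx using Submodule.span_induction with
    | mem x hx => exact subset_hull (hs x hx)
    | zero => simp
    | add x y _ _ hx hy => rw [neg_add]; exact add_mem hx hy
    | smul c x _ hx => rw [← smul_neg]; exact smul_mem _ c.2 hx
  intro x hx
  induction hx using Submodule.span_induction with
  | mem x hx => exact subset_hull hx
  | zero => simp
  | add x y _ _ hx hy => exact add_mem hx hy
  | smul c x _ hx =>
    rcases le_total 0 c with hc | hc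
    · exact smul_mem _ hc hx
    · rw [← neg_smul_neg]
      exact smul_mem _ (neg_nonneg.2 hc) (hneg x hx)

theorem exists_finset_subspace_subset_hull [FiniteDimensional ℝ V] {L : Submodule ℤ V}
    {W : Submodule ℝ V} (hWL : Submodule.span ℝ ((W : Set V) ∩ L) = W) :
    ∃ s : Finset V, (s : Set V) ⊆ (W : Set V) ∩ L ∧ (W : Set V) ⊆ hull ℝ (s : Set V) := by
  classical
  obtain ⟨t, htW, htspan, hli⟩ := exists_linearIndependent ℝ ((W : Set V) ∩ L)
  have htfin : t.Finite := hli.setFinite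
  let s : Finset V := htfin.toFinset ∪ htfin.toFinset.image fun x => -x
  have hs : (s : Set V) = t ∪ (fun x => -x) '' t := by simp [s]
  refine ⟨s, ?_, ?_⟩
  · rw [hs]
    rintro x (hx | ⟨y, hy, rfl⟩)
    · exact htW hx
    · exact ⟨W.neg_mem (htW hy).1, L.neg_mem (htW hy).2⟩
  · rw [hs]
    refine subset_trans ?_ (span_subset_hull_of_neg_mem ?_)
    · rw [hWL] at htspan
      rw [← htspan]
      exact Submodule.span_mono Set.subset_union_left
    · rintro x (hx | ⟨y, hy, rfl⟩)
      · exact Or.inr ⟨x, hx, rfl⟩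
      · rw [neg_neg]; exact Or.inl hy

/-- A polyhedral cone in the quotient whose translates cover the image of `C` lifts to a cone
generated by lattice points whose translates cover `C`. -/
theorem exists_finset_cover [FiniteDimensional ℝ V] {VZ L : Submodule ℤ V}
    (hVL : ratPoints VZ ⊆ ratPoints L) {Γ : Type*} [Group Γ] {ρ : Γ →* (V ≃ₗ[ℝ] V)}
    {C : ConvexCone ℝ V} (hCne : (C : Set V).Nonempty) {W : Submodule ℝ V}
    (hW : (W : Set V) ⊆ closure (C : Set V)) (hWL : Submodule.span ℝ ((W : Set V) ∩ L) = W)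
    (hρW : ∀ γ, W.map (ρ γ : V →ₗ[ℝ] V) = W)
    (hpoly : IsPolyhedralType (quotientLattice VZ W) (W.mkQ '' (C : Set V))
      (quotientAction ρ W hρW).range.subtype) :
    ∃ s : Finset V, (s : Set V) ⊆ closure (C : Set V) ∩ L ∧
      (W : Set V) ⊆ hull ℝ (s : Set V) ∧
      (C : Set V) ⊆ ⋃ γ, ρ γ '' (hull ℝ (s : Set V) : Set V) := by
  classical
  obtain ⟨_, ⟨t, rfl⟩, htC, hcover⟩ := hpoly
  have hlift : ∀ y ∈ t, ∃ x ∈ hull ℝ (closure (C : Set V) ∩ L), W.mkQ x = y := fun y hy =>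
    conePlus_quotient_subset hVL hCne hW (htC (subset_hull hy))
  choose! p hpA hp using hlift
  obtain ⟨s₁, hs₁, hps₁⟩ := exists_finset_subset_hull (A := closure (C : Set V) ∩ L)
    (t.image p) (by
      intro x hx
      obtain ⟨y, hy, rfl⟩ := Finset.mem_image.1 hx
      exact hpA y hy)
  obtain ⟨s₂, hs₂, hWs₂⟩ := exists_finset_subspace_subset_hull hWL
  have hle₁ : hull ℝ (s₁ : Set V) ≤ hull ℝ ((s₁ ∪ s₂ : Finset V) : Set V) :=
    Submodule.span_mono (by simp)
  have hle₂ : hull ℝ (s₂ : Set V) ≤ hull ℝ ((s₁ ∪ s₂ : Finset V) : Set V) :=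
    Submodule.span_mono (by simp)
  refine ⟨s₁ ∪ s₂, ?_, hWs₂.trans hle₂, fun x hx => ?_⟩
  · rw [Finset.coe_union]
    exact Set.union_subset hs₁ fun x hx => ⟨hW (hs₂ hx).1, (hs₂ hx).2⟩
  · obtain ⟨⟨_, γ, rfl⟩, y, hy, hyx⟩ := Set.mem_iUnion.1 (hcover ⟨x, hx, rfl⟩)
    have hy' : y ∈ W.mkQ '' (hull ℝ (s₁ : Set V) : Set V) := by
      rw [← hull_image_mkQ]
      refine Submodule.span_le.2 (fun z hz => ?_) hy
      rw [SetLike.mem_coe, ← SetLike.mem_coe, hull_image_mkQ]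
      exact ⟨p z, hps₁ (Finset.mem_image_of_mem p hz), hp z hz⟩
    obtain ⟨z, hz, rfl⟩ := hy'
    have hzx : x - ρ γ z ∈ W := by
      rw [← Submodule.Quotient.mk_eq_zero W, Submodule.Quotient.mk_sub, sub_eq_zero]
      exact hyx.symm
    -- The lifted cone covers x only modulo W; the error is pulled back by γ and absorbed, since the
    -- hull of s₂ contains W.
    have hw : ρ γ⁻¹ (x - ρ γ z) ∈ W := (hρW γ⁻¹).le ⟨_, hzx, rfl⟩
    refine Set.mem_iUnion.2 ⟨γ, z + ρ γ⁻¹ (x - ρ γ z), add_mem (hle₁ hz) (hle₂ (hWs₂ hw)), ?_⟩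
    rw [map_add, apply_apply_inv, add_sub_cancel]

theorem span_inter_lattice_eq {VZ L : Submodule ℤ V} (hVL : ratPoints VZ ⊆ ratPoints L)
    {W : Submodule ℝ V} (hWQ : IsDefinedOverRat VZ W) :
    Submodule.span ℝ ((W : Set V) ∩ L) = W := by
  refine le_antisymm (Submodule.span_le.2 fun x hx => hx.1) ?_
  conv_lhs => rw [← hWQ]
  refine Submodule.span_le.2 fun x hx => ?_
  obtain ⟨n, hn, hnx⟩ := hVL hx.2
  have hn' : (n : ℝ) ≠ 0 := Nat.cast_ne_zero.2 hn.ne'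
  have hmem : n • x ∈ (W : Set V) ∩ L := ⟨W.toAddSubgroup.nsmul_mem hx.1 n, hnx⟩
  have := Submodule.smul_mem (Submodule.span ℝ ((W : Set V) ∩ L)) (n : ℝ)⁻¹
    (Submodule.subset_span hmem)
  rwa [← Nat.cast_smul_eq_nsmul ℝ, inv_smul_smul₀ hn'] at this

end Reduction

/-! ### The main theorem -/

theorem proposition3 {V : Type*} [NormedAddCommGroup V] [NormedSpace ℝ V] [FiniteDimensional ℝ V]
    -- the lattice `V(ℤ)` in `V = V(ℤ) ⊗ ℝ`
    (VZ : Submodule ℤ V) [DiscreteTopology VZ] [IsZLattice ℝ VZ]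
    {Γ : Type*} [Group Γ] (ρ : Γ →* (V ≃ₗ[ℝ] V))
    (C : ConvexCone ℝ V) (hCopen : IsOpen (C : Set V)) (hCne : (C : Set V).Nonempty)
    (hCinv : ∀ γ, ρ γ '' (C : Set V) = C)
    -- some lattice in `V(ℚ)` is invariant
    (hLinv : ∃ (L : Submodule ℤ V) (_ : DiscreteTopology L), IsZLattice ℝ L ∧
      (L : Set V) ⊆ ratPoints VZ ∧ ∀ γ, ρ γ '' (L : Set V) = L)
    (W : Submodule ℝ V) (hW : IsMaximalSubspace (C : Set V) W) (hWQ : IsDefinedOverRat VZ W)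
    -- the image of `C` in `V ⧸ W`, with the image of `Γ` in `GL(V ⧸ W)`
    (hpoly : IsPolyhedralType (quotientLattice VZ W) (W.mkQ '' (C : Set V))
      (quotientAction ρ W (hW.map_eq hCinv)).range.subtype) :
    ∃ P : Set V, IsRationalPolyhedralCone VZ P ∧ P ⊆ conePlus VZ (C : Set V) ∧
      (⋃ γ : Γ, ρ γ '' P) = conePlus VZ (C : Set V) ∧
      (∀ γ : Γ, ρ γ '' P ∩ intrinsicInterior ℝ P = ∅ ∨ ρ γ '' P = P) ∧
      {γ : Γ | ρ γ '' P = P} =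
        {γ : Γ | ∀ x : V ⧸ W, quotientAction ρ W (hW.map_eq hCinv) γ x = x} := by
  obtain ⟨L, hLd, hLz, hLV, hLimg⟩ := hLinv
  have hLspan : Submodule.span ℝ (L : Set V) = ⊤ := IsZLattice.span_top
  have hVL : ratPoints VZ ⊆ ratPoints L := ratPoints_subset_ratPoints hLspan hLV
  have hρL : ∀ γ, ∀ x ∈ L, ρ γ x ∈ L := fun γ x hx => by
    have : ρ γ x ∈ ρ γ '' (L : Set V) := ⟨x, hx, rfl⟩
    rwa [hLimg γ] at this
  have hρC : ∀ γ, ∀ x ∈ closure (C : Set V), ρ γ x ∈ closure (C : Set V) := fun γ x hx => by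
    have := image_closure_subset_closure_image
      (LinearMap.continuous_of_finiteDimensional (ρ γ : V →ₗ[ℝ] V)) ⟨x, hx, rfl⟩
    rwa [show (ρ γ : V →ₗ[ℝ] V) '' (C : Set V) = C from hCinv γ] at this
  have hρW : ∀ γ, ∀ x ∈ W, ρ γ x ∈ W := fun γ x hx =>
    (hW.map_eq hCinv γ).le ⟨x, hx, rfl⟩
  have hWL := span_inter_lattice_eq hVL hWQ
  obtain ⟨s, hsA, hWs, hCs⟩ := exists_finset_cover hVL hCne hW.1 hWL (hW.map_eq hCinv) hpoly
  set A := closure (C : Set V) ∩ (L : Set V)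
  have hA : ∀ γ, ∀ x ∈ A, ρ γ x ∈ A := fun γ x hx => ⟨hρC γ x hx.1, hρL γ x hx.2⟩
  have hsK : hull ℝ (s : Set V) ≤ hull ℝ A := Submodule.span_mono hsA
  have hCA : (C : Set V) ⊆ hull ℝ A := fun x hx => by
    obtain ⟨γ, y, hy, rfl⟩ := Set.mem_iUnion.1 (hCs hx)
    exact apply_mem_hull hA γ (hsK hy)
  have hAspan : Submodule.span ℝ A = ⊤ := by
    refine Submodule.eq_top_of_nonempty_interior' _ (hCne.mono ?_)
    exact interior_maximal (hCA.trans (hull_le_span ℝ A)) hCopen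
  obtain ⟨ξ, hξL, hξC, hstab⟩ := exists_integral_functional hρL hCne hρC hAspan hW hWL
  have hξW : ∀ x ∈ W, ξ x = 0 := fun x hx => functional_eq_zero_of_mem_subspace hW.1 hξC hx
  have hξA : ∀ x ∈ A, ∃ k : ℕ, ξ x = k := fun x hx => by
    obtain ⟨k, hk⟩ := hξL x hx.2
    have h0 := hξC x hx.1
    rw [hk, Int.cast_nonneg_iff] at h0
    lift k to ℕ using h0
    exact ⟨k, by simpa using hk⟩
  have hAC : interior (hull ℝ A : Set V) ⊆ C := by
    have hle : (hull ℝ A : Set V) ⊆ closure (C : Set V) := fun x hx => by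
      induction hx using Submodule.span_induction with
      | mem x hx => exact hx.1
      | zero => exact zero_mem_closure_cone hCne
      | add x y _ _ hx hy => exact add_mem_closure_cone hx hy
      | smul c x _ hx => exact smul_mem_closure_cone hCne c.2 hx
    -- An open convex set is the interior of its closure.
    refine (interior_mono hle).trans ?_
    rw [C.convex.interior_closure_eq_interior_of_nonempty_interior
      (by rwa [hCopen.interior_eq]), hCopen.interior_eq]
  obtain ⟨r, hrL, hr⟩ := exists_finset_hull_eq_dirichletCone hLspan hρL hξL
    Set.inter_subset_right hA hξA hCopen hCne hAC hρW hξW hstab hsA hWs hCs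
  have hint := nonempty_interior_dirichletCone hLspan hρL hξL hA hξA hCopen hCne hCA
  have hplus := conePlus_eq_hull hLV hVL hCne
  set D := dirichletCone ρ ξ (hull ℝ A)
  have htriv : ∀ γ, (∀ x, ρ γ x - x ∈ W) ↔
      ∀ x : V ⧸ W, quotientAction ρ W (hW.map_eq hCinv) γ x = x := fun γ => by
    refine ⟨fun h x => ?_, fun h x => ?_⟩
    · obtain ⟨x, rfl⟩ := W.mkQ_surjective x
      exact sub_eq_zero.1 ((Submodule.Quotient.mk_eq_zero W).2 (h x))
    · exact (Submodule.Quotient.mk_eq_zero W).1 (sub_eq_zero.2 (h (W.mkQ x)))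
  have hsub : ∀ γ, (∀ x, ρ γ x - x ∈ W) → ∀ x ∈ D, ρ γ x ∈ D := fun γ h x hx => by
    -- W ⊆ D because ξ is zero on the invariant subspace W; D is closed under addition.
    have hw : ρ γ x - x ∈ D := ⟨hsK (hWs (h x)), fun γ' => by
      rw [hξW _ (h x), hξW _ (hρW γ' _ (h x))]⟩
    have := add_mem hx hw
    rwa [add_sub_cancel] at this
  have hfix : ∀ γ, (∀ x, ρ γ x - x ∈ W) → ρ γ '' (D : Set V) = D := fun γ h => by
    refine subset_antisymm (Set.image_subset_iff.2 (hsub γ h)) fun x hx => ?_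
    refine ⟨ρ γ⁻¹ x, hsub γ⁻¹ (fun y => ?_) x hx, apply_apply_inv ρ γ x⟩
    have := hρW γ⁻¹ _ (W.neg_mem (h y))
    rwa [neg_sub, map_sub, apply_inv_apply] at this
  have hinter : ∀ γ, ∀ y ∈ ρ γ '' (D : Set V), y ∈ interior (D : Set V) →
      ∀ x, ρ γ x - x ∈ W := fun γ y hy hy' =>
    hstab γ (functional_invariant_of_mem_interior hy hy')
  refine ⟨D, ⟨r, hrL.trans hLV, by rw [hr]⟩, ?_, ?_, fun γ => ?_, ?_⟩
  · rw [hplus]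
    exact fun x hx => hx.1
  · rw [hplus]
    exact iUnion_image_dirichletCone hA hξA
  · by_cases h : ρ γ '' (D : Set V) ∩ intrinsicInterior ℝ (D : Set V) = ∅
    · exact Or.inl h
    · obtain ⟨y, hy, hy'⟩ := Set.nonempty_iff_ne_empty.2 h
      exact Or.inr (hfix γ (hinter γ y hy (intrinsicInterior_subset_interior hint hy')))
  · ext γ
    rw [Set.mem_ofPred_eq, Set.mem_ofPred_eq, ← htriv]
    refine ⟨fun h => ?_, hfix γ⟩
    -- If γD = D, any interior point of D also lies in γD, so the intersection argument applies.
    obtain ⟨y, hy⟩ := hint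
    exact hinter γ y (h.ge (interior_subset hy)) hy
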